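/- **Setting.** Let $G$ be a compact group and $L\ge 1$. An $L$-layer $G$-equivariant architecture consists of Hilbert spaces $\mathcal H_j=\mathbb C^{D_j}$ with continuous unitary representations $R^{(j)}$ of $G$, $j=0,\dots,L$, and, for every layer $j=1,\dots,L$, a unitary change of basis realizing the isotypic decomposition $$\mathcal H_{j-1}\otimes\mathcal H_j\simeq\bigoplus_\lambda \mathbb C^{d_\lambda}\otimes\mathbb C^{m_{j,\lambda}},\qquad R^{(j-1)*}\otimes R^{(j)}\simeq\bigoplus_\lambda \pi_\lambda\otimes \mathbb I_{m_{j,\lambda}},$$ where $\lambda$ runs over the pairwise inequivalent irreducible representations $\pi_\lambda$ (of dimension $d_\lambda$) that occur, with multiplicities $m_{j,\lambda}\ge1$. Parameters are $w=\{W_{j,\lambda}\}$ with $W_{j,\lambda}\in\mathbb C^{m_{j,\lambda}\times m_{j,\lambda}}$. Layer $j$ is the linear map $\phi_j$ whose (unnormalized) Choi operator is, in the irrep basis, $$J^{\phi_j}\simeq\bigoplus_\lambda \mathbb I_{d_\lambda}\otimes\Big(\tfrac{1}{D_j}\mathbb I_{m_{j,\lambda}}+W_{j,\lambda}\Big).$$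 Call $w$ admissible if every $\phi_j$ is a quantum channel (completely positive and trace preserving); it is then automatically equivariant. Let $K=D_L$, let $x\mapsto\rho(x)$ be a measurable map from a measurable space $\mathcal X$ to density matrices on $\mathcal H_0$, and let $f_w(x)[k]=\langle k|\,\phi_L\circ\dots\circ\phi_1(\rho(x))\,|k\rangle$ for $k=1,\dots,K$. For a probability distribution $\mathcal D$ on $\mathcal X\times\{1,\dots,K\}$ let $L_\gamma(f)=\mathbb P_{(x,y)\sim\mathcal D}\big[f(x)[y]\le\gamma+\max_{k\ne y}f(x)[k]\big]$ (with $\max\emptyset=-\infty$), and let $\hat L_\gamma(f)$ be the corresponding fraction of the $N$ training examples. Put - $\|W_j\|_{\mathrm{eq},1}=\sum_\lambda d_\lambda\|W_{j,\lambda}\|_1$ (trace norms) and $\|W_j\|_{\mathrm{eq},F}^2=\sum_\lambda d_\lambda\|W_{j,\lambda}\|_F^2$; - $\Xi_j=\sum_\lambda m_{j,\lambda}^2$, $\Xi_{\max}=\max_j\Xi_j$, and $d_{\max}$ the largest $d_\lambda$ over all layers; - $\beta_{\mathrm{eq}}=\sum_{j=1}^L\prod_{\ell=j+1}^L\|W_\ell\|_{\mathrm{eq},1}$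 and $\eta=\max_{j,\lambda}\|W_{j,\lambda}\|_\infty$ (spectral norm); - $M=\sum_{k=0}^{L-1}\big(\eta\sqrt{|G|\,\Xi_{\max}}\big)^k=\dfrac{(\eta\sqrt{|G|\Xi_{\max}})^L-1}{\eta\sqrt{|G|\Xi_{\max}}-1}$ (the quotient when its denominator is nonzero and $G$ is finite), where for infinite $G$ we set $|G|=\infty$, with $0\cdot\infty=0$ and $\infty^0=1$; - $\log^+x=\max\{0,\ln x\}$. **Theorem.** There is an absolute constant $C>0$ such that for every such architecture, encoding $\rho$ and distribution $\mathcal D$, every $N\ge1$, $\gamma>0$ and $0<\delta<1$, with probability at least $1-\delta$ over a training set of $N$ i.i.d. samples from $\mathcal D$, simultaneously for all admissible $w$, $$L_0(f_w)\le\hat L_\gamma(f_w)+C\sqrt{\frac{d_{\max}^2\,\Xi_{\max}\ln\!\Big(\sum_{j=1}^L2^{\Xi_j}\Big)\beta_{\mathrm{eq}}^2\sum_{j=1}^L\|W_j\|_{\mathrm{eq},F}^2+\log^+\!\left(\frac{N L}{\delta}\,\min\left\{\frac{\gamma\sqrt N}{\sqrt{\sum_{j=1}^L\|W_j\|_{\mathrm{eq},F}^2}},\,M\right\}\right)}{\gamma^2N}}\,,$$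 where the quotient in the minimum is $+\infty$ if all $W_{j,\lambda}$ vanish. -/

import Mathlib

open MeasureTheory
open scoped Kronecker ENNReal NNReal Matrix ComplexOrder

noncomputable section

namespace EquivariantQML

/-! ### Matrix norms -/

/-- The trace norm `‖A‖₁`: the sum of the singular values of `A`, i.e. of the square roots of the
eigenvalues of `Aᴴ * A`. -/
def traceNorm {n : ℕ} (A : Matrix (Fin n) (Fin n) ℂ) : ℝ :=
  ∑ i, Real.sqrt ((Matrix.posSemidef_conjTranspose_mul_self A).isHermitian.eigenvalues i)

/-- The Frobenius norm `‖A‖_F`. -/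
def frobeniusNorm {n : ℕ} (A : Matrix (Fin n) (Fin n) ℂ) : ℝ :=
  Real.sqrt (∑ i, ∑ k, ‖A i k‖ ^ 2)

/-- The spectral norm `‖A‖_∞` (operator norm on Euclidean space). -/
def spectralNorm {n : ℕ} (A : Matrix (Fin n) (Fin n) ℂ) : ℝ≥0 :=
  ‖Matrix.toEuclideanCLM (n := Fin n) (𝕜 := ℂ) A‖₊

/-! ### States and channels -/

/-- Density matrices. -/
def IsDensityMatrix {n : ℕ} (ρ : Matrix (Fin n) (Fin n) ℂ) : Prop :=
  ρ.PosSemidef ∧ ρ.trace = 1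

/-- The map `id_k ⊗ Φ` on block matrices. -/
def ampliation {a b : ℕ} (k : ℕ) (Φ : Matrix (Fin a) (Fin a) ℂ →ₗ[ℂ] Matrix (Fin b) (Fin b) ℂ)
    (X : Matrix (Fin k × Fin a) (Fin k × Fin a) ℂ) :
    Matrix (Fin k × Fin b) (Fin k × Fin b) ℂ :=
  Matrix.of fun p q => Φ (Matrix.of fun i j => X (p.1, i) (q.1, j)) p.2 q.2

/-- Quantum channels: completely positive and trace-preserving linear maps. -/
structure IsChannel {a b : ℕ}
    (Φ : Matrix (Fin a) (Fin a) ℂ →ₗ[ℂ] Matrix (Fin b) (Fin b) ℂ) : Prop where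
  completelyPositive : ∀ (k : ℕ) (X : Matrix (Fin k × Fin a) (Fin k × Fin a) ℂ),
    X.PosSemidef → (ampliation k Φ X).PosSemidef
  tracePreserving : ∀ X, (Φ X).trace = X.trace

/-- The (unnormalized) Choi operator `∑ i j, E_ij ⊗ Φ(E_ij)` of a linear map. -/
def choi {a b : ℕ} (Φ : Matrix (Fin a) (Fin a) ℂ →ₗ[ℂ] Matrix (Fin b) (Fin b) ℂ) :
    Matrix (Fin a × Fin b) (Fin a × Fin b) ℂ :=
  ∑ i, ∑ j, Matrix.single i j (1 : ℂ) ⊗ₖ Φ (Matrix.single i j 1)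

/-- The linear map with Choi operator `J`, see `choi_ofChoi`. -/
def ofChoi {a b : ℕ} (J : Matrix (Fin a × Fin b) (Fin a × Fin b) ℂ) :
    Matrix (Fin a) (Fin a) ℂ →ₗ[ℂ] Matrix (Fin b) (Fin b) ℂ where
  toFun ρ := Matrix.of fun k l => ∑ i, ∑ j, ρ i j * J (i, k) (j, l)
  map_add' ρ σ := by
    ext k l
    simp [add_mul, Finset.sum_add_distrib]
  map_smul' c ρ := by
    ext k l
    simp [mul_assoc, Finset.mul_sum]

theorem choi_ofChoi {a b : ℕ} (J : Matrix (Fin a × Fin b) (Fin a × Fin b) ℂ) :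
    choi (ofChoi J) = J := by
  ext ⟨i, k⟩ ⟨j, l⟩
  simp [choi, ofChoi, Matrix.sum_apply, Matrix.single_apply, ite_and]

theorem ofChoi_kronecker_mul {a b : ℕ} (U : Matrix (Fin a) (Fin a) ℂ)
    (V : Matrix (Fin b) (Fin b) ℂ) (J : Matrix (Fin a × Fin b) (Fin a × Fin b) ℂ)
    (X : Matrix (Fin a) (Fin a) ℂ) :
    ofChoi ((U.map star ⊗ₖ V) * J) X = V * ofChoi J (Uᴴ * X) := by
  ext k l
  simp only [ofChoi, LinearMap.coe_mk, AddHom.coe_mk, Matrix.of_apply, Matrix.mul_apply,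
    Fintype.sum_prod_type, Matrix.kroneckerMap_apply, Matrix.map_apply, Matrix.conjTranspose_apply,
    Finset.mul_sum, Finset.sum_mul]
  calc _ = ∑ i, ∑ i', ∑ j, ∑ k', X i j * (star (U i i') * V k k' * J (i', k') (j, l)) :=
        Finset.sum_congr rfl fun i _ => Finset.sum_comm
    _ = ∑ i', ∑ i, ∑ j, ∑ k', X i j * (star (U i i') * V k k' * J (i', k') (j, l)) :=
        Finset.sum_comm
    _ = ∑ i', ∑ j, ∑ k', ∑ i, X i j * (star (U i i') * V k k' * J (i', k') (j, l)) := by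
        refine Finset.sum_congr rfl fun i' _ => ?_
        rw [Finset.sum_comm]
        exact Finset.sum_congr rfl fun j _ => Finset.sum_comm
    _ = ∑ i', ∑ k', ∑ j, ∑ i, X i j * (star (U i i') * V k k' * J (i', k') (j, l)) :=
        Finset.sum_congr rfl fun i' _ => Finset.sum_comm
    _ = ∑ k', ∑ i', ∑ j, ∑ i, X i j * (star (U i i') * V k k' * J (i', k') (j, l)) :=
        Finset.sum_comm
    _ = _ := by
        refine Finset.sum_congr rfl fun _ _ => Finset.sum_congr rfl fun _ _ =>
          Finset.sum_congr rfl fun _ _ => Finset.sum_congr rfl fun _ _ => ?_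
        ring

theorem ofChoi_mul_kronecker {a b : ℕ} (U : Matrix (Fin a) (Fin a) ℂ)
    (V : Matrix (Fin b) (Fin b) ℂ) (J : Matrix (Fin a × Fin b) (Fin a × Fin b) ℂ)
    (X : Matrix (Fin a) (Fin a) ℂ) :
    ofChoi (J * (U.map star ⊗ₖ V)) X = ofChoi J (X * Uᴴ) * V := by
  ext k l
  simp only [ofChoi, LinearMap.coe_mk, AddHom.coe_mk, Matrix.of_apply, Matrix.mul_apply,
    Fintype.sum_prod_type, Matrix.kroneckerMap_apply, Matrix.map_apply, Matrix.conjTranspose_apply,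
    Finset.mul_sum, Finset.sum_mul]
  calc _ = ∑ i, ∑ j', ∑ j, ∑ l', X i j * (J (i, k) (j', l') * (star (U j' j) * V l' l)) :=
        Finset.sum_congr rfl fun i _ => Finset.sum_comm
    _ = ∑ i, ∑ j', ∑ l', ∑ j, X i j * (J (i, k) (j', l') * (star (U j' j) * V l' l)) :=
        Finset.sum_congr rfl fun i _ => Finset.sum_congr rfl fun j' _ => Finset.sum_comm
    _ = ∑ i, ∑ l', ∑ j', ∑ j, X i j * (J (i, k) (j', l') * (star (U j' j) * V l' l)) :=
        Finset.sum_congr rfl fun i _ => Finset.sum_comm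
    _ = ∑ l', ∑ i, ∑ j', ∑ j, X i j * (J (i, k) (j', l') * (star (U j' j) * V l' l)) :=
        Finset.sum_comm
    _ = _ := by
        refine Finset.sum_congr rfl fun _ _ => Finset.sum_congr rfl fun _ _ =>
          Finset.sum_congr rfl fun _ _ => Finset.sum_congr rfl fun _ _ => ?_
        ring

/-! ### Unitary representations and isotypic decompositions -/

/-- The linear representation on `ℂⁿ` underlying a continuous unitary matrix representation. -/
def linRep {G : Type*} [Group G] [TopologicalSpace G] {n : ℕ}
    (R : G →ₜ* Matrix.unitaryGroup (Fin n) ℂ) : Representation ℂ G (Fin n → ℂ) :=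
  (Matrix.toLinAlgEquiv' (R := ℂ) (n := Fin n)).toMonoidHom.comp
    ((Matrix.unitaryGroup (Fin n) ℂ).subtype.comp R.toMonoidHom)

/-- The product representation `R_in^* ⊗ R_out` on `H_in ⊗ H_out`, where `R_in^*` is the complex
conjugate of `R_in`. -/
def choiRep {G : Type*} [Group G] [TopologicalSpace G] {a b : ℕ}
    (Rin : G →ₜ* Matrix.unitaryGroup (Fin a) ℂ) (Rout : G →ₜ* Matrix.unitaryGroup (Fin b) ℂ)
    (g : G) : Matrix (Fin a × Fin b) (Fin a × Fin b) ℂ :=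
  ((Rin g : Matrix (Fin a) (Fin a) ℂ).map star) ⊗ₖ (Rout g : Matrix (Fin b) (Fin b) ℂ)

/-- An isotypic decomposition `H_in ⊗ H_out ≃ ⨁_λ H_λ ⊗ ℂ^(m_λ)` of `R_in^* ⊗ R_out`: the pairwise
inequivalent irreducible representations `λ` that occur, their dimensions `d_λ` and multiplicities
`m_λ`, and the unitary change of basis to the irrep basis. -/
structure IsotypicDecomposition {G : Type*} [Group G] [TopologicalSpace G] {a b : ℕ}
    (Rin : G →ₜ* Matrix.unitaryGroup (Fin a) ℂ)
    (Rout : G →ₜ* Matrix.unitaryGroup (Fin b) ℂ) where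
  numIrreps : ℕ
  irrepDim : Fin numIrreps → ℕ
  mult : Fin numIrreps → ℕ
  mult_pos : ∀ μ, 0 < mult μ
  irrep : ∀ μ, G →ₜ* Matrix.unitaryGroup (Fin (irrepDim μ)) ℂ
  irreducible : ∀ μ, (linRep (irrep μ)).IsIrreducible
  inequivalent : ∀ μ ν, μ ≠ ν → IsEmpty ((linRep (irrep μ)).Equiv (linRep (irrep ν)))
  basis : Matrix (Fin a × Fin b) (Σ μ, Fin (irrepDim μ) × Fin (mult μ)) ℂ
  basis_mul_conjTranspose : basis * basisᴴ = 1
  conjTranspose_mul_basis : basisᴴ * basis = 1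
  conj_choiRep : ∀ g, basisᴴ * choiRep Rin Rout g * basis =
    Matrix.blockDiagonal' fun μ =>
      (irrep μ g : Matrix (Fin (irrepDim μ)) (Fin (irrepDim μ)) ℂ) ⊗ₖ
        (1 : Matrix (Fin (mult μ)) (Fin (mult μ)) ℂ)

namespace IsotypicDecomposition

variable {G : Type*} [Group G] [TopologicalSpace G] {a b : ℕ}
  {Rin : G →ₜ* Matrix.unitaryGroup (Fin a) ℂ} {Rout : G →ₜ* Matrix.unitaryGroup (Fin b) ℂ}
  (I : IsotypicDecomposition Rin Rout)

/-- Layer parameters: one `m_λ × m_λ` matrix for every irrep `λ`. -/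
abbrev Weights : Type :=
  ∀ μ : Fin I.numIrreps, Matrix (Fin (I.mult μ)) (Fin (I.mult μ)) ℂ

/-- The Choi operator `⨁_λ 1_(d_λ) ⊗ (1_(m_λ) / d_out + W_λ)`, written in the computational
basis. -/
def choiOp (W : I.Weights) : Matrix (Fin a × Fin b) (Fin a × Fin b) ℂ :=
  I.basis *
    (Matrix.blockDiagonal' fun μ =>
      (1 : Matrix (Fin (I.irrepDim μ)) (Fin (I.irrepDim μ)) ℂ) ⊗ₖ
        ((b : ℂ)⁻¹ • (1 : Matrix (Fin (I.mult μ)) (Fin (I.mult μ)) ℂ) + W μ)) *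
    I.basisᴴ

/-- The layer map with parameters `W`. -/
def layer (W : I.Weights) : Matrix (Fin a) (Fin a) ℂ →ₗ[ℂ] Matrix (Fin b) (Fin b) ℂ :=
  ofChoi (I.choiOp W)

theorem choiRep_mul_choiOp (W : I.Weights) (g : G) :
    choiRep Rin Rout g * I.choiOp W = I.choiOp W * choiRep Rin Rout g := by
  have h1 : choiRep Rin Rout g = I.basis * (I.basisᴴ * choiRep Rin Rout g * I.basis) * I.basisᴴ := by
    simp only [Matrix.mul_assoc, I.basis_mul_conjTranspose, Matrix.mul_one]
    rw [← Matrix.mul_assoc, I.basis_mul_conjTranspose, Matrix.one_mul]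
  have h2 : ∀ S T : Matrix (Σ μ, Fin (I.irrepDim μ) × Fin (I.mult μ))
      (Σ μ, Fin (I.irrepDim μ) × Fin (I.mult μ)) ℂ,
      (I.basis * S * I.basisᴴ) * (I.basis * T * I.basisᴴ) = I.basis * (S * T) * I.basisᴴ := by
    intro S T
    calc _ = I.basis * S * (I.basisᴴ * I.basis) * T * I.basisᴴ := by
          simp only [Matrix.mul_assoc]
      _ = _ := by rw [I.conjTranspose_mul_basis, Matrix.mul_one, Matrix.mul_assoc I.basis]
  rw [h1, I.conj_choiRep, choiOp, h2, h2]
  simp only [← Matrix.blockDiagonal'_mul, ← Matrix.mul_kronecker_mul, Matrix.one_mul,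
    Matrix.mul_one]

/-- Every layer map is `(G, R_in, R_out)`-equivariant. -/
theorem layer_equivariant (W : I.Weights) (g : G) (X : Matrix (Fin a) (Fin a) ℂ) :
    I.layer W ((Rin g : Matrix (Fin a) (Fin a) ℂ) * X * (Rin g : Matrix (Fin a) (Fin a) ℂ)ᴴ) =
      (Rout g : Matrix (Fin b) (Fin b) ℂ) * I.layer W X *
        (Rout g : Matrix (Fin b) (Fin b) ℂ)ᴴ := by
  have hin : (Rin g : Matrix (Fin a) (Fin a) ℂ)ᴴ * (Rin g : Matrix (Fin a) (Fin a) ℂ) = 1 :=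
    Unitary.coe_star_mul_self (Rin g)
  have hout : (Rout g : Matrix (Fin b) (Fin b) ℂ) * (Rout g : Matrix (Fin b) (Fin b) ℂ)ᴴ = 1 :=
    Unitary.coe_mul_star_self (Rout g)
  have h := I.choiRep_mul_choiOp W g
  unfold choiRep at h
  have h' := congrArg (fun J => ofChoi J ((Rin g : Matrix (Fin a) (Fin a) ℂ) * X)) h
  simp only [ofChoi_kronecker_mul, ofChoi_mul_kronecker] at h'
  rw [← Matrix.mul_assoc, hin, Matrix.one_mul] at h'
  simp only [layer]
  rw [h', Matrix.mul_assoc (ofChoi _ _), hout, Matrix.mul_one]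

/-- The number of equivariant parameters `Ξ = ∑_λ m_λ²`. -/
def numParams : ℕ := ∑ μ, I.mult μ ^ 2

/-- The largest irrep dimension `max_λ d_λ`. -/
def maxIrrepDim : ℕ := Finset.univ.sup I.irrepDim

/-- `‖W‖_{eq,1} = ∑_λ d_λ ‖W_λ‖₁`. -/
def eqNorm1 (W : I.Weights) : ℝ := ∑ μ, (I.irrepDim μ : ℝ) * traceNorm (W μ)

/-- `‖W‖_{eq,F} = (∑_λ d_λ ‖W_λ‖_F²)^(1/2)`. -/
def eqNormF (W : I.Weights) : ℝ :=
  Real.sqrt (∑ μ, (I.irrepDim μ : ℝ) * frobeniusNorm (W μ) ^ 2)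

/-- `max_λ ‖W_λ‖_∞`. -/
def maxSpectralNorm (W : I.Weights) : ℝ≥0 := Finset.univ.sup fun μ => spectralNorm (W μ)

end IsotypicDecomposition

/-! ### Equivariant quantum models -/

/-- The architecture of an `L`-layer `G`-equivariant quantum model: Hilbert spaces `ℂ^(dim j)` and
unitary representations `R^(j)` of `G` on them, for `j = 0, …, L`, and for every layer an isotypic
decomposition of the product representation of its input and output representations. -/
structure Architecture (G : Type*) [Group G] [TopologicalSpace G] (L : ℕ) where
  dim : Fin (L + 1) → ℕ
  rep : ∀ j, G →ₜ* Matrix.unitaryGroup (Fin (dim j)) ℂ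
  iso : ∀ j : Fin L, IsotypicDecomposition (rep j.castSucc) (rep j.succ)

namespace Architecture

variable {G : Type*} [Group G] [TopologicalSpace G] {L : ℕ} (A : Architecture G L)

/-- The number `K` of classes, which is the dimension of the final Hilbert space. -/
abbrev numClasses : ℕ := A.dim (Fin.last L)

/-- The parameters `w = (W_{j,λ})` of a model. -/
abbrev Params : Type := ∀ j : Fin L, (A.iso j).Weights

/-- The parameters `w` define an equivariant quantum model if every layer is a quantum channel;
equivariance is automatic by `IsotypicDecomposition.layer_equivariant`. -/
def IsModel (w : A.Params) : Prop := ∀ j, IsChannel ((A.iso j).layer (w j))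

/-- The state after `j` layers. -/
def state (w : A.Params) (ρ : Matrix (Fin (A.dim 0)) (Fin (A.dim 0)) ℂ) (j : Fin (L + 1)) :
    Matrix (Fin (A.dim j)) (Fin (A.dim j)) ℂ :=
  Fin.induction (motive := fun j => Matrix (Fin (A.dim j)) (Fin (A.dim j)) ℂ) ρ
    (fun j σ => (A.iso j).layer (w j) σ) j

/-- The output `f_w(x)[k] = Tr(|k⟩⟨k| ρ_out(x))` for the data encoding `ρ`. -/
def output (w : A.Params) {X : Type*} (ρ : X → Matrix (Fin (A.dim 0)) (Fin (A.dim 0)) ℂ) (x : X)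
    (k : Fin A.numClasses) : ℝ :=
  (Matrix.trace (Matrix.single k k (1 : ℂ) * A.state w (ρ x) (Fin.last L))).re

/-- `Ξ_max`. -/
def maxNumParams : ℕ := Finset.univ.sup fun j => (A.iso j).numParams

/-- `d_max`, over all irreps of all layers. -/
def maxIrrepDim : ℕ := Finset.univ.sup fun j => (A.iso j).maxIrrepDim

/-- `β_eq = ∑_j ∏_{ℓ > j} ‖W_ℓ‖_{eq,1}`. -/
def beta (w : A.Params) : ℝ :=
  ∑ j, ∏ l ∈ Finset.Ioi j, (A.iso l).eqNorm1 (w l)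

/-- `∑_j ‖W_j‖_{eq,F}²`. -/
def sumSqNorm (w : A.Params) : ℝ := ∑ j, (A.iso j).eqNormF (w j) ^ 2

/-- `η = max_{j,λ} ‖W_{j,λ}‖_∞`. -/
def eta (w : A.Params) : ℝ≥0 := Finset.univ.sup fun j => (A.iso j).maxSpectralNorm (w j)

/-- `M = ((η √(|G| Ξ_max))^L - 1) / (η √(|G| Ξ_max) - 1)`, written as a geometric sum, which also
covers the case of denominator `0`, and valued in `[0, ∞]`, since `G` may be infinite. -/
def betaCap (w : A.Params) : ℝ≥0∞ :=
  ∑ k ∈ Finset.range L,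
    ((A.eta w : ℝ≥0∞) *
      ((ENat.card G : ℝ≥0∞) * (A.maxNumParams : ℝ≥0∞)) ^ (1 / 2 : ℝ)) ^ k

/-- `min {γ √N / (∑_j ‖W_j‖_{eq,F}²)^(1/2), M}`. The quotient is `∞` if all parameters vanish, and
then `M = 1`; so the minimum is always finite. -/
def netSize (w : A.Params) (N : ℕ) (γ : ℝ) : ℝ :=
  (min (ENNReal.ofReal (γ * Real.sqrt N) / ENNReal.ofReal (Real.sqrt (A.sumSqNorm w)))
    (A.betaCap w)).toReal

/-- The numerator of the complexity term. Here `log⁺ x = max 0 (log x)`. -/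
def complexity (w : A.Params) (N : ℕ) (γ δ : ℝ) : ℝ :=
  (A.maxIrrepDim : ℝ) ^ 2 * A.maxNumParams *
      Real.log (∑ j : Fin L, (2 : ℝ) ^ (A.iso j).numParams) * A.beta w ^ 2 * A.sumSqNorm w
    + Real.posLog (N * L * A.netSize w N γ / δ)

end Architecture

/-! ### Margin losses -/

/-- The event `f(x)[y] ≤ γ + max_{k ≠ y} f(x)[k]`. -/
def MarginError {X : Type*} {K : ℕ} (f : X → Fin K → ℝ) (γ : ℝ) (z : X × Fin K) : Prop :=
  ∃ k, k ≠ z.2 ∧ f z.1 z.2 ≤ γ + f z.1 k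

/-- The expected margin loss `L_γ(f)`. -/
def expectedLoss {X : Type*} [MeasurableSpace X] {K : ℕ} (D : Measure (X × Fin K))
    (f : X → Fin K → ℝ) (γ : ℝ) : ℝ :=
  D.real {z | MarginError f γ z}

open Classical in
/-- The empirical margin loss on the sample `s`. -/
def empiricalLoss {X : Type*} {K N : ℕ} (s : Fin N → X × Fin K) (f : X → Fin K → ℝ) (γ : ℝ) : ℝ :=
  (∑ i, if MarginError f γ (s i) then (1 : ℝ) else 0) / N

end EquivariantQML

end

noncomputable section

namespace EquivariantQML

/-! ### Bounded differences -/

/-! An admissible model is, on density matrices, a constant plus a linear map with small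
coefficients, so a Rademacher bound for linear margin classifiers suffices.

Structure. The scalar part of the Choi operator sends a state to the maximally mixed one; the rest
has Frobenius norm `eqNormF`, because the basis change is unitary and reshuffling the Choi matrix
only permutes entries. Composing layers, with `eqNormF ≤ eqNorm1`, gives the recursion whose
solution is `beta`. Hence (`IsModel.exists_output_eq`) every output is `1/K` plus a linear form in
the real coordinates of `(1, ρ)`. The feature vector has squared length at most `2`, and all `K`
coefficient vectors together have norm at most `B = beta * √sumSqNorm`. The common constant `1/K`
does not affect margins.

Statistics. For a fixed radius, `measure_exists_linear_margin_le` replaces the margin losses by a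
ramp of slope of order `1/γ`, discretizes the class, and combines McDiarmid's inequality with
symmetrization. Contraction for the vector of scores is done by randomizing the coordinate, which
costs a factor `K`. This is affordable: counting dimensions in the last isotypic decomposition gives
`K ≤ d_max Ξ_max`, and `Ξ_max` is at most twice the logarithm of `∑ 2^Ξ_j`, so `K²` is dominated by
the factor in front of `beta² * sumSqNorm` (`sq_numClasses_mul_le`).

Uniformity in `w`. The radius `B` depends on `w`, so the fixed-radius bound is applied at `γ, 2γ, …,
Nγ` with confidence `δ/N` each. Outside this range nothing is to be shown: if `3B ≤ γ` or `γ ≥ 1`,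
no margin exceeds `γ`; if `B ≥ γ√N`, the complexity term is at least `1`. In between, the cost `log
(N/δ)` of the union bound is below the `log⁺` term, because there both entries of its minimum are at
least `1`. -/

theorem integrable_of_abs_le {Ω : Type*} [MeasurableSpace Ω] {μ : Measure Ω} [IsFiniteMeasure μ]
    {f : Ω → ℝ} (hf : Measurable f) {M : ℝ} (h : ∀ x, |f x| ≤ M) : Integrable f μ :=
  Integrable.of_bound hf.aestronglyMeasurable M (Filter.Eventually.of_forall h)

theorem abs_integral_le_of_abs_le {Ω : Type*} [MeasurableSpace Ω] {μ : Measure Ω}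
    [IsProbabilityMeasure μ] {f : Ω → ℝ} {M : ℝ} (h : ∀ x, |f x| ≤ M) : |∫ x, f x ∂μ| ≤ M := by
  have h' : ∀ x, ‖f x‖ ≤ M := h
  simpa using norm_integral_le_of_norm_le_const (μ := μ) (Filter.Eventually.of_forall h')

theorem measurable_finCons {Z : Type*} [MeasurableSpace Z] {n : ℕ} :
    Measurable fun p : Z × (Fin n → Z) => (Fin.cons p.1 p.2 : Fin (n + 1) → Z) := by
  refine measurable_pi_lambda _ fun i => ?_
  refine Fin.cases ?_ (fun j => ?_) i
  · simpa using measurable_fst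
  · simp only [Fin.cons_succ]
    fun_prop

theorem integral_pi_succ {Z : Type*} [MeasurableSpace Z] (D : Measure Z) [IsProbabilityMeasure D]
    {n : ℕ} {f : (Fin (n + 1) → Z) → ℝ} (hf : Measurable f) {M : ℝ} (hM : ∀ s, |f s| ≤ M) :
    ∫ s, f s ∂(Measure.pi fun _ : Fin (n + 1) => D) =
      ∫ z, ∫ r, f (Fin.cons z r) ∂(Measure.pi fun _ : Fin n => D) ∂D := by
  have h := (measurePreserving_piFinSuccAbove (fun _ : Fin (n + 1) => D) 0).symm
  rw [← h.integral_comp' (g := f), integral_prod]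
  · simp [MeasurableEquiv.piFinSuccAbove, Fin.insertNthEquiv, Fin.insertNth_zero']
  · exact integrable_of_abs_le (hf.comp (MeasurableEquiv.measurable _)) fun _ => hM _

theorem measurable_integral_finCons {Z : Type*} [MeasurableSpace Z] (D : Measure Z)
    [IsProbabilityMeasure D] {n : ℕ} {f : (Fin (n + 1) → Z) → ℝ} (hf : Measurable f) :
    Measurable fun z => ∫ r, f (Fin.cons z r) ∂(Measure.pi fun _ : Fin n => D) :=
  (StronglyMeasurable.integral_prod_right (ν := Measure.pi fun _ : Fin n => D)
    (f := fun z r => f (Fin.cons z r)) (hf.comp measurable_finCons).stronglyMeasurable).measurable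

/-- The martingale argument as an induction: average out all coordinates but the first, apply the
induction hypothesis to each slice, then Hoeffding's lemma to the slice means, which inherit the
bounded difference `c`. -/
theorem integral_exp_le_of_bounded_differences {Z : Type*} [MeasurableSpace Z] (D : Measure Z)
    [IsProbabilityMeasure D] {c : ℝ} (hc : 0 ≤ c) (t : ℝ) {M : ℝ} :
    ∀ (n : ℕ) (F : (Fin n → Z) → ℝ), Measurable F → (∀ s, |F s| ≤ M) →
      (∀ s i z, |F (Function.update s i z) - F s| ≤ c) →
      ∫ s, Real.exp (t * F s) ∂(Measure.pi fun _ : Fin n => D) ≤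
        Real.exp (t * (∫ s, F s ∂(Measure.pi fun _ : Fin n => D)) + n * (c ^ 2 * t ^ 2 / 2)) := by
  intro n
  induction n with
  | zero =>
    intro F _ _ _
    have h : ∀ s, F s = F default := fun s => congrArg F (Subsingleton.elim _ _)
    simp only [h]
    simp
  | succ n ih =>
    intro F hF hM hd
    have hexp : ∀ s, |Real.exp (t * F s)| ≤ Real.exp (|t| * M) := by
      intro s
      rw [abs_of_pos (Real.exp_pos _)]
      refine Real.exp_le_exp.2 ((le_abs_self _).trans ?_)
      rw [abs_mul]
      exact mul_le_mul_of_nonneg_left (hM s) (abs_nonneg _)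
    have hFe : Measurable fun s => Real.exp (t * F s) := (hF.const_mul t).exp
    rw [integral_pi_succ D hFe hexp, integral_pi_succ D hF hM]
    set m : Z → ℝ := fun z => ∫ r, F (Fin.cons z r) ∂(Measure.pi fun _ : Fin n => D) with hm
    have hFc : ∀ z, Measurable fun r : Fin n → Z => F (Fin.cons z r) := fun z =>
      hF.comp (measurable_finCons.comp measurable_prodMk_left)
    have hmm : Measurable m := measurable_integral_finCons D hF
    have hmM : ∀ z, |m z| ≤ M := fun z => abs_integral_le_of_abs_le fun r => hM _
    have hmd : ∀ z z', |m z - m z'| ≤ c := by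
      intro z z'
      rw [hm, ← integral_sub (integrable_of_abs_le (hFc z) fun r => hM _)
        (integrable_of_abs_le (hFc z') fun r => hM _)]
      refine abs_integral_le_of_abs_le fun r => ?_
      simpa [Fin.update_cons_zero] using hd (Fin.cons z' r) 0 z
    have hstep : ∀ z, ∫ r, Real.exp (t * F (Fin.cons z r)) ∂(Measure.pi fun _ : Fin n => D) ≤
        Real.exp (t * m z + n * (c ^ 2 * t ^ 2 / 2)) := by
      intro z
      refine ih _ (hFc z) (fun r => hM _) fun s i w => ?_
      simpa [Fin.cons_update] using hd (Fin.cons z s) i.succ w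
    obtain ⟨z₀⟩ : Nonempty Z := D.nonempty_of_neZero
    -- An interval centred at an arbitrary value of `m` has length `2 * c` instead of `c`; this
    -- gives `c ^ 2 * t ^ 2 / 2` where the sharp exponent has denominator `8`.
    have hsub := ProbabilityTheory.hasSubgaussianMGF_of_mem_Icc (μ := D) (X := m) (a := m z₀ - c)
      (b := m z₀ + c) hmm.aemeasurable (Filter.Eventually.of_forall fun z => by
        have := abs_le.1 (hmd z z₀)
        constructor <;> linarith)
    have hmgf := hsub.mgf_le t
    have hcc : ((‖m z₀ + c - (m z₀ - c)‖₊ / 2) ^ 2 : ℝ≥0) = (c ^ 2 : ℝ) := by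
      push_cast
      rw [Real.norm_eq_abs, show m z₀ + c - (m z₀ - c) = 2 * c by ring,
        abs_of_nonneg (by positivity)]
      ring
    rw [hcc] at hmgf
    have hem : ∀ z, |Real.exp (t * m z)| ≤ Real.exp (|t| * M) := by
      intro z
      rw [abs_of_pos (Real.exp_pos _)]
      refine Real.exp_le_exp.2 ((le_abs_self _).trans ?_)
      rw [abs_mul]
      exact mul_le_mul_of_nonneg_left (hmM z) (abs_nonneg _)
    have hint : Integrable (fun z => Real.exp (t * m z)) D :=
      integrable_of_abs_le (hmm.const_mul t).exp hem
    have hmgf' : ∫ z, Real.exp (t * m z) ∂D ≤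
        Real.exp (t * (∫ z, m z ∂D) + c ^ 2 * t ^ 2 / 2) := by
      have h1 : ProbabilityTheory.mgf (fun z => m z - ∫ z, m z ∂D) D t =
          (∫ z, Real.exp (t * m z) ∂D) * Real.exp (-(t * ∫ z, m z ∂D)) := by
        rw [ProbabilityTheory.mgf, ← integral_mul_const]
        congr 1 with z
        rw [← Real.exp_add]
        refine congrArg Real.exp ?_
        ring
      rw [h1, Real.exp_neg, ← div_eq_mul_inv, div_le_iff₀ (Real.exp_pos _), ← Real.exp_add] at hmgf
      rwa [add_comm] at hmgf
    calc ∫ z, ∫ r, Real.exp (t * F (Fin.cons z r)) ∂(Measure.pi fun _ : Fin n => D) ∂D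
        ≤ ∫ z, Real.exp (t * m z) * Real.exp (n * (c ^ 2 * t ^ 2 / 2)) ∂D := by
          refine integral_mono (integrable_of_abs_le (measurable_integral_finCons D hFe)
            fun z => abs_integral_le_of_abs_le fun r => hexp _) (hint.mul_const _) fun z => ?_
          simpa only [← Real.exp_add] using hstep z
      _ = (∫ z, Real.exp (t * m z) ∂D) * Real.exp (n * (c ^ 2 * t ^ 2 / 2)) :=
          integral_mul_const _ _
      _ ≤ Real.exp (t * (∫ z, m z ∂D) + c ^ 2 * t ^ 2 / 2) *
            Real.exp (n * (c ^ 2 * t ^ 2 / 2)) :=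
          mul_le_mul_of_nonneg_right hmgf' (Real.exp_pos _).le
      _ = _ := by
          rw [← Real.exp_add]
          refine congrArg Real.exp ?_
          push_cast
          ring

/-- **McDiarmid's inequality**, with a constant that is not optimal. -/
theorem measureReal_ge_le_of_bounded_differences {Z : Type*} [MeasurableSpace Z] (D : Measure Z)
    [IsProbabilityMeasure D] {c : ℝ} (hc : 0 < c) {M : ℝ} {n : ℕ} (hn : 0 < n)
    {F : (Fin n → Z) → ℝ} (hF : Measurable F) (hM : ∀ s, |F s| ≤ M)
    (hd : ∀ s i z, |F (Function.update s i z) - F s| ≤ c) {ε : ℝ} (hε : 0 ≤ ε) :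
    (Measure.pi fun _ : Fin n => D).real
        {s | (∫ s, F s ∂(Measure.pi fun _ : Fin n => D)) + ε ≤ F s} ≤
      Real.exp (-(ε ^ 2 / (2 * (n * c ^ 2)))) := by
  have hn' : (0 : ℝ) < n := by exact_mod_cast hn
  -- The minimizer of the Chernoff exponent `-t * ε + n * c ^ 2 * t ^ 2 / 2`.
  set t : ℝ := ε / (n * c ^ 2) with ht
  have ht0 : 0 ≤ t := by positivity
  have hexp : ∀ s, |Real.exp (t * F s)| ≤ Real.exp (|t| * M) := by
    intro s
    rw [abs_of_pos (Real.exp_pos _)]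
    refine Real.exp_le_exp.2 ((le_abs_self _).trans ?_)
    rw [abs_mul]
    exact mul_le_mul_of_nonneg_left (hM s) (abs_nonneg _)
  refine (ProbabilityTheory.measure_ge_le_exp_mul_mgf _ ht0
    (integrable_of_abs_le (hF.const_mul t).exp hexp)).trans ?_
  refine (mul_le_mul_of_nonneg_left (integral_exp_le_of_bounded_differences D hc.le t n F hF hM hd)
    (Real.exp_pos _).le).trans ?_
  rw [← Real.exp_add]
  refine Real.exp_le_exp.2 (le_of_eq ?_)
  have h1 : n * c ^ 2 * t = ε := by
    rw [ht]
    field_simp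
  have h2 : ε ^ 2 / (2 * (n * c ^ 2)) = t * ε / 2 := by
    rw [ht]
    field_simp
  rw [h2]
  linear_combination (t / 2) * h1

/-! ### Finite suprema -/

section FiniteSup

variable {T : Type*} [Finite T]

theorem le_iSup_of_finite (f : T → ℝ) (t : T) : f t ≤ ⨆ t, f t :=
  le_ciSup (Set.finite_range f).bddAbove t

theorem abs_iSup_le [Nonempty T] {f : T → ℝ} {M : ℝ} (h : ∀ t, |f t| ≤ M) : |⨆ t, f t| ≤ M := by
  obtain ⟨t⟩ := ‹Nonempty T›
  exact abs_le.2 ⟨(abs_le.1 (h t)).1.trans (le_iSup_of_finite f t),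
    have : Nonempty T := ⟨t⟩; ciSup_le fun t => (abs_le.1 (h t)).2⟩

theorem abs_iSup_sub_iSup_le [Nonempty T] {f g : T → ℝ} {c : ℝ} (h : ∀ t, |f t - g t| ≤ c) :
    |(⨆ t, f t) - ⨆ t, g t| ≤ c := by
  have key : ∀ f g : T → ℝ, (∀ t, |f t - g t| ≤ c) → (⨆ t, f t) ≤ (⨆ t, g t) + c := by
    intro f g h
    exact ciSup_le fun t => by linarith [(abs_le.1 (h t)).2, le_iSup_of_finite g t]
  rw [abs_le]
  constructor
  · linarith [key g f fun t => by rw [abs_sub_comm]; exact h t]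
  · linarith [key f g h]

theorem exists_iSup_add_iSup_eq [Nonempty T] (f g : T → ℝ) :
    ∃ t t', (⨆ t, f t) + (⨆ t, g t) = f t + g t' := by
  obtain ⟨t, ht⟩ := exists_eq_ciSup_of_finite (f := f)
  obtain ⟨t', ht'⟩ := exists_eq_ciSup_of_finite (f := g)
  exact ⟨t, t', by rw [ht, ht']⟩

/-- The two suprema may be tested at different indices; the sign of `u t - u t'` decides which index
goes with the plus sign. -/
theorem add_add_mul_abs_sub_le (A u : T → ℝ) (c : ℝ) (t t' : T) :
    A t + A t' + c * |u t - u t'| ≤ (⨆ t, (A t + c * u t)) + ⨆ t, (A t - c * u t) := by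
  have h1 := le_iSup_of_finite (fun t => A t + c * u t) t
  have h2 := le_iSup_of_finite (fun t => A t - c * u t) t
  have h3 := le_iSup_of_finite (fun t => A t + c * u t) t'
  have h4 := le_iSup_of_finite (fun t => A t - c * u t) t'
  rcases abs_cases (u t - u t') with ⟨h, -⟩ | ⟨h, -⟩ <;> rw [h] <;> linarith

/-- Contraction: a function that is Lipschitz for the sup norm of `v` is replaced by a random
coordinate of `v`. -/
theorem iSup_add_iSup_le_sum [Nonempty T] {K : ℕ} (hK : 0 < K) (A g : T → ℝ) (v : T → Fin K → ℝ)
    {l : ℝ} (hl : 0 ≤ l) (hg : ∀ t t', ∃ k, |g t - g t'| ≤ l * |v t k - v t' k|) :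
    (⨆ t, (A t + 2 * g t)) + (⨆ t, (A t - 2 * g t)) ≤
      (K : ℝ)⁻¹ * ∑ k, ((⨆ t, (A t + 2 * l * K * v t k)) + ⨆ t, (A t - 2 * l * K * v t k)) := by
  have hK' : (0 : ℝ) < K := by exact_mod_cast hK
  obtain ⟨t, t', h⟩ := exists_iSup_add_iSup_eq (fun t => A t + 2 * g t) fun t => A t - 2 * g t
  rw [h, inv_mul_eq_div, le_div_iff₀ hK']
  obtain ⟨k₀, hk₀⟩ := hg t t'
  calc (A t + 2 * g t + (A t' - 2 * g t')) * K
      ≤ (A t + A t') * K + 2 * l * K * |v t k₀ - v t' k₀| := by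
        nlinarith [le_abs_self (g t - g t')]
    -- The good coordinate `k₀` depends on the pair of maximizers, so it is absorbed into the sum
    -- over all coordinates. This is where the factor `K` is lost.
    _ ≤ (A t + A t') * K + ∑ k, 2 * l * K * |v t k - v t' k| := by
        gcongr
        exact Finset.single_le_sum (f := fun k => 2 * l * K * |v t k - v t' k|)
          (fun _ _ => by positivity) (Finset.mem_univ k₀)
    _ = ∑ k : Fin K, (A t + A t' + 2 * l * K * |v t k - v t' k|) := by
        rw [Finset.sum_add_distrib]
        simp [mul_comm, add_mul]
    _ ≤ _ := Finset.sum_le_sum fun k _ => add_add_mul_abs_sub_le A (fun t => v t k) _ t t'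

end FiniteSup

/-! ### Expected suprema of sums of independent variables -/

theorem integral_pi_succ' {Z : Type*} [MeasurableSpace Z] (D : Measure Z) [IsProbabilityMeasure D]
    {n : ℕ} {f : (Fin (n + 1) → Z) → ℝ} (hf : Measurable f) {M : ℝ} (hM : ∀ s, |f s| ≤ M) :
    ∫ s, f s ∂(Measure.pi fun _ : Fin (n + 1) => D) =
      ∫ r, ∫ z, f (Fin.cons z r) ∂D ∂(Measure.pi fun _ : Fin n => D) := by
  rw [integral_pi_succ D hf hM]
  exact integral_integral_swap (f := fun z r => f (Fin.cons z r))
    (integrable_of_abs_le (hf.comp measurable_finCons) fun _ => hM _)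

theorem abs_iSup_add_sum_le {T W : Type*} [Finite T] [Nonempty T] {A : T → ℝ} {q : T → W → ℝ}
    {C M : ℝ} {n : ℕ} (s : Fin n → W) (hA : ∀ t, |A t| ≤ C) (hq : ∀ t z, |q t z| ≤ M) :
    |⨆ t, (A t + ∑ i, q t (s i))| ≤ C + n * M := by
  refine abs_iSup_le fun t => (abs_add_le _ _).trans (add_le_add (hA t) ?_)
  refine (Finset.abs_sum_le_sum_abs _ _).trans ((Finset.sum_le_sum fun i _ => hq t (s i)).trans ?_)
  simp

theorem measurable_iSup_add_sum {T W : Type*} [Finite T] [MeasurableSpace W] {q : T → W → ℝ}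
    (hq : ∀ t, Measurable (q t)) (A : T → ℝ) (n : ℕ) :
    Measurable fun s : Fin n → W => ⨆ t, (A t + ∑ i, q t (s i)) :=
  Measurable.iSup fun t => measurable_const.add (Finset.measurable_sum _ fun i _ =>
    (hq t).comp (measurable_pi_apply i))

/-- Summands are exchanged one at a time: a comparison for a single variable that holds for every
offset `A` tensorizes, since the remaining summands can be put into the offset. Fubini moves the
variable to be replaced to the inside. -/
theorem integral_iSup_sum_le_of_forall {T Z Z' : Type*} [Finite T] [Nonempty T]
    [MeasurableSpace Z] [MeasurableSpace Z'] (D : Measure Z) [IsProbabilityMeasure D]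
    (D' : Measure Z') [IsProbabilityMeasure D'] {p : T → Z → ℝ} {h : T → Z' → ℝ}
    (hp : ∀ t, Measurable (p t)) (hh : ∀ t, Measurable (h t)) {M : ℝ}
    (hpM : ∀ t z, |p t z| ≤ M) (hhM : ∀ t z, |h t z| ≤ M)
    (hstep : ∀ A : T → ℝ, ∫ z, ⨆ t, (A t + p t z) ∂D ≤ ∫ z, ⨆ t, (A t + h t z) ∂D') :
    ∀ (n : ℕ) (A : T → ℝ),
      ∫ s, ⨆ t, (A t + ∑ i, p t (s i)) ∂(Measure.pi fun _ : Fin n => D) ≤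
        ∫ s, ⨆ t, (A t + ∑ i, h t (s i)) ∂(Measure.pi fun _ : Fin n => D') := by
  have hb : ∀ (A : T → ℝ), ∃ C, ∀ t, |A t| ≤ C := fun A => by
    obtain ⟨C, hC⟩ := (Set.finite_range fun t => |A t|).bddAbove
    exact ⟨C, fun t => hC ⟨t, rfl⟩⟩
  intro n
  induction n with
  | zero => intro A; simp
  | succ n ih =>
    intro A
    obtain ⟨C, hC⟩ := hb A
    have hCp : ∀ z t, |A t + p t z| ≤ C + M := fun z t =>
      (abs_add_le _ _).trans (add_le_add (hC t) (hpM t z))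
    have hmeas := measurable_iSup_add_sum hp A (n + 1)
    have hmeas' := measurable_iSup_add_sum hh A (n + 1)
    have hjoint : Measurable fun x : Z × (Fin n → Z') =>
        ⨆ t, (A t + p t x.1 + ∑ i, h t (x.2 i)) := by
      refine Measurable.iSup fun t => ?_
      refine (measurable_const.add ((hp t).comp measurable_fst)).add
        (Finset.measurable_sum _ fun i _ => (hh t).comp ?_)
      exact (measurable_pi_apply i).comp measurable_snd
    have hjointb : ∀ x : Z × (Fin n → Z'),
        |⨆ t, (A t + p t x.1 + ∑ i, h t (x.2 i))| ≤ C + M + n * M := fun x =>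
      abs_iSup_add_sum_le x.2 (hCp x.1) hhM
    rw [integral_pi_succ D (hmeas) fun s => abs_iSup_add_sum_le s hC hpM,
      integral_pi_succ' D' hmeas' fun s => abs_iSup_add_sum_le s hC hhM]
    simp only [Fin.sum_univ_succ, Fin.cons_zero, Fin.cons_succ]
    have hj : Measurable fun x : Z' × (Fin n → Z') =>
        ⨆ t, (A t + (h t x.1 + ∑ i, h t (x.2 i))) := by
      simpa only [Function.comp_def, Fin.sum_univ_succ, Fin.cons_zero, Fin.cons_succ] using
        hmeas'.comp measurable_finCons
    have i1 : Integrable (fun z => ∫ r, ⨆ t, (A t + (p t z + ∑ i, p t (r i)))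
        ∂(Measure.pi fun _ : Fin n => D)) D := by
      have hm := measurable_integral_finCons D (hmeas)
      have hb := fun z (r : Fin n → Z) => abs_iSup_add_sum_le (Fin.cons z r : Fin (n + 1) → Z) hC hpM
      simp only [Fin.sum_univ_succ, Fin.cons_zero, Fin.cons_succ] at hm hb
      exact integrable_of_abs_le hm fun z => abs_integral_le_of_abs_le (hb z)
    have i2 : Integrable (fun z => ∫ r, ⨆ t, (A t + p t z + ∑ i, h t (r i))
        ∂(Measure.pi fun _ : Fin n => D')) D := by
      have hm := (StronglyMeasurable.integral_prod_right (ν := Measure.pi fun _ : Fin n => D')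
        (f := fun z (r : Fin n → Z') => ⨆ t, (A t + p t z + ∑ i, h t (r i))) hjoint.stronglyMeasurable).measurable
      exact integrable_of_abs_le hm fun z => abs_integral_le_of_abs_le fun r => hjointb (z, r)
    have i3 : Integrable (fun r => ∫ z, ⨆ t, (A t + p t z + ∑ i, h t (r i)) ∂D)
        (Measure.pi fun _ : Fin n => D') := by
      have hm := (StronglyMeasurable.integral_prod_left (μ := D)
        (f := fun z (r : Fin n → Z') => ⨆ t, (A t + p t z + ∑ i, h t (r i))) hjoint.stronglyMeasurable).measurable
      exact integrable_of_abs_le hm fun r => abs_integral_le_of_abs_le fun z => hjointb (z, r)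
    have i4 : Integrable (fun r => ∫ z, ⨆ t, (A t + (h t z + ∑ i, h t (r i))) ∂D')
        (Measure.pi fun _ : Fin n => D') := by
      have hm := (StronglyMeasurable.integral_prod_left (μ := D')
        (f := fun z (r : Fin n → Z') => ⨆ t, (A t + (h t z + ∑ i, h t (r i)))) hj.stronglyMeasurable).measurable
      have hb := fun z (r : Fin n → Z') => abs_iSup_add_sum_le (Fin.cons z r : Fin (n + 1) → Z') hC hhM
      simp only [Fin.sum_univ_succ, Fin.cons_zero, Fin.cons_succ] at hb
      exact integrable_of_abs_le hm fun r => abs_integral_le_of_abs_le fun z => hb z r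
    calc ∫ z, ∫ r, ⨆ t, (A t + (p t z + ∑ i, p t (r i))) ∂(Measure.pi fun _ : Fin n => D) ∂D
        ≤ ∫ z, ∫ r, ⨆ t, (A t + p t z + ∑ i, h t (r i)) ∂(Measure.pi fun _ : Fin n => D') ∂D := by
          refine integral_mono i1 i2 fun z => ?_
          simpa only [add_assoc] using ih fun t => A t + p t z
      _ = ∫ r, ∫ z, ⨆ t, (A t + p t z + ∑ i, h t (r i)) ∂D ∂(Measure.pi fun _ : Fin n => D') :=
          integral_integral_swap (f := fun z (r : Fin n → Z') => ⨆ t, (A t + p t z + ∑ i, h t (r i)))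
            (integrable_of_abs_le hjoint hjointb)
      _ ≤ ∫ r, ∫ z, ⨆ t, (A t + (h t z + ∑ i, h t (r i))) ∂D'
            ∂(Measure.pi fun _ : Fin n => D') := by
          refine integral_mono i3 i4 fun r => ?_
          have := hstep fun t => A t + ∑ i, h t (r i)
          simpa only [add_assoc, add_comm, add_left_comm] using this

/-- Cross terms vanish because `f` is centred; the offset `x` carries the coordinates already
conditioned on through the induction. -/
theorem integral_sq_add_sum {Z : Type*} [MeasurableSpace Z] (D : Measure Z)
    [IsProbabilityMeasure D] {f : Z → ℝ} (hf : Measurable f) {M : ℝ} (hM : ∀ z, |f z| ≤ M)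
    (h0 : ∫ z, f z ∂D = 0) :
    ∀ (n : ℕ) (x : ℝ), ∫ s, (x + ∑ i, f (s i)) ^ 2 ∂(Measure.pi fun _ : Fin n => D) =
      x ^ 2 + n * ∫ z, f z ^ 2 ∂D := by
  intro n
  induction n with
  | zero => intro x; simp
  | succ n ih =>
    intro x
    have hb : ∀ s : Fin (n + 1) → Z, |(x + ∑ i, f (s i)) ^ 2| ≤ (|x| + (n + 1 : ℕ) * M) ^ 2 := by
      intro s
      rw [abs_pow]
      refine pow_le_pow_left₀ (abs_nonneg _) ((abs_add_le _ _).trans (add_le_add le_rfl ?_)) 2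
      refine (Finset.abs_sum_le_sum_abs _ _).trans ((Finset.sum_le_sum fun i _ => hM (s i)).trans ?_)
      simp
    have hm : Measurable fun s : Fin (n + 1) → Z => (x + ∑ i, f (s i)) ^ 2 := by fun_prop
    rw [integral_pi_succ D hm hb]
    simp only [Fin.sum_univ_succ, Fin.cons_zero, Fin.cons_succ, ← add_assoc, ih]
    have hi : Integrable f D := integrable_of_abs_le hf hM
    have hi2 : Integrable (fun z => f z ^ 2) D := integrable_of_abs_le (M := M ^ 2) (by fun_prop)
      fun z => by rw [abs_pow]; exact pow_le_pow_left₀ (abs_nonneg _) (hM z) 2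
    have : ∀ z, (x + f z) ^ 2 + n * ∫ z, f z ^ 2 ∂D =
        (x ^ 2 + n * ∫ z, f z ^ 2 ∂D) + (2 * x * f z + f z ^ 2) := fun z => by ring
    simp only [this]
    have hi' : Integrable (fun z => 2 * x * f z + f z ^ 2) D := (hi.const_mul _).add hi2
    rw [integral_add (integrable_const _) hi', integral_add (hi.const_mul _) hi2,
      integral_const_mul, h0]
    simp
    ring

/-! ### Symmetrization and contraction -/

/-- The uniform distribution on signed coordinates. -/
def signedCoord (K : ℕ) [NeZero K] : Measure (Fin K × Bool) :=
  (PMF.uniformOfFintype (Fin K × Bool)).toMeasure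

instance (K : ℕ) [NeZero K] : IsProbabilityMeasure (signedCoord K) := by
  unfold signedCoord
  infer_instance

/-- The sign of a Boolean. -/
def boolSign (b : Bool) : ℝ := if b then 1 else -1

theorem abs_boolSign (b : Bool) : |boolSign b| = 1 := by cases b <;> simp [boolSign]

theorem boolSign_sq (b : Bool) : boolSign b ^ 2 = 1 := by cases b <;> simp [boolSign]

theorem integral_prod_signedCoord {Z : Type*} [MeasurableSpace Z] (D : Measure Z)
    [IsProbabilityMeasure D] {K : ℕ} [NeZero K] {f : Z × (Fin K × Bool) → ℝ} (hf : Measurable f)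
    {M : ℝ} (hM : ∀ x, |f x| ≤ M) :
    ∫ x, f x ∂(D.prod (signedCoord K)) =
      ∫ z, (2 * K : ℝ)⁻¹ * ∑ k, (f (z, k, true) + f (z, k, false)) ∂D := by
  rw [integral_prod _ (integrable_of_abs_le hf hM)]
  refine integral_congr_ae (Filter.Eventually.of_forall fun z => ?_)
  simp only [signedCoord, PMF.integral_eq_sum, PMF.uniformOfFintype_apply, smul_eq_mul]
  rw [Finset.mul_sum, Fintype.sum_prod_type]
  simp [mul_add, mul_comm]

section Symmetrization

variable {T Z : Type*} [Fintype T] [Nonempty T] [MeasurableSpace Z]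

/-- Symmetrization and contraction for one sample point. The arbitrary offset `A` is what
`integral_iSup_sum_le_of_forall` needs to pass to `N` points. -/
theorem integral_iSup_add_centered_le (D : Measure Z) [IsProbabilityMeasure D] {K : ℕ} [NeZero K]
    {g : T → Z → ℝ} {v : T → Z → Fin K → ℝ} (hg : ∀ t, Measurable (g t))
    (hv : ∀ t k, Measurable fun z => v t z k) {M : ℝ} (hgM : ∀ t z, |g t z| ≤ M)
    (hvM : ∀ t z k, |v t z k| ≤ M) {l : ℝ} (hl : 0 ≤ l)
    (hlip : ∀ z t t', ∃ k, |g t z - g t' z| ≤ l * |v t z k - v t' z k|) (A : T → ℝ) :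
    ∫ z, ⨆ t, (A t + ((∫ y, g t y ∂D) - g t z)) ∂D ≤
      ∫ x, ⨆ t, (A t + boolSign x.2.2 * (2 * l * K * v t x.1 x.2.1)) ∂(D.prod (signedCoord K)) := by
  obtain ⟨C, hC⟩ : ∃ C, ∀ t, |A t| ≤ C := by
    obtain ⟨C, hC⟩ := (Set.finite_range fun t => |A t|).bddAbove
    exact ⟨C, fun t => hC ⟨t, rfl⟩⟩
  have hK : (0 : ℝ) < K := by exact_mod_cast Nat.pos_of_ne_zero (NeZero.ne K)
  have hplus : Measurable fun z => ⨆ t, (A t + 2 * g t z) :=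
    Measurable.iSup fun t => measurable_const.add ((hg t).const_mul 2)
  have hminus : Measurable fun z => ⨆ t, (A t - 2 * g t z) :=
    Measurable.iSup fun t => measurable_const.sub ((hg t).const_mul 2)
  have hplusb : ∀ z, |⨆ t, (A t + 2 * g t z)| ≤ C + 2 * M := fun z => abs_iSup_le fun t =>
    (abs_add_le _ _).trans (add_le_add (hC t) (by rw [abs_mul, abs_two]; linarith [hgM t z]))
  have hminusb : ∀ z, |⨆ t, (A t - 2 * g t z)| ≤ C + 2 * M := fun z => abs_iSup_le fun t =>
    (abs_sub _ _).trans (add_le_add (hC t) (by rw [abs_mul, abs_two]; linarith [hgM t z]))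
  have iplus := integrable_of_abs_le (μ := D) hplus hplusb
  have iminus := integrable_of_abs_le (μ := D) hminus hminusb
  have hcent : Measurable fun z => ⨆ t, (A t + ((∫ y, g t y ∂D) - g t z)) :=
    Measurable.iSup fun t => measurable_const.add (measurable_const.sub (hg t))
  have hcentb : ∀ z, |⨆ t, (A t + ((∫ y, g t y ∂D) - g t z))| ≤ C + (M + M) := fun z =>
    abs_iSup_le fun t => (abs_add_le _ _).trans (add_le_add (hC t)
      ((abs_sub _ _).trans (add_le_add (abs_integral_le_of_abs_le (hgM t)) (hgM t z))))
  have hs : Measurable fun x : Z × (Fin K × Bool) =>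
      ⨆ t, (A t + boolSign x.2.2 * (2 * l * K * v t x.1 x.2.1)) := by
    refine measurable_from_prod_countable_left fun y => ?_
    exact Measurable.iSup fun t => measurable_const.add
      (((hv t y.1).const_mul (2 * l * K)).const_mul (boolSign y.2))
  have hsb : ∀ x : Z × (Fin K × Bool),
      |⨆ t, (A t + boolSign x.2.2 * (2 * l * K * v t x.1 x.2.1))| ≤ C + 2 * l * K * M := fun x =>
    abs_iSup_le fun t => (abs_add_le _ _).trans (add_le_add (hC t) (by
      rw [abs_mul, abs_boolSign, one_mul, abs_mul, abs_of_nonneg (by positivity)]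
      exact mul_le_mul_of_nonneg_left (hvM t _ _) (by positivity)))
  rw [integral_prod_signedCoord D hs hsb]
  -- Split the term as half of `A t + 2 * E g` plus half of `A t - 2 * g`, and move the supremum
  -- inside the expectation. After integration in `z` this is the average of the supremum over a
  -- random sign.
  have hpt : ∀ z, ⨆ t, (A t + ((∫ y, g t y ∂D) - g t z)) ≤
      2⁻¹ * (∫ y, ⨆ t, (A t + 2 * g t y) ∂D) + 2⁻¹ * ⨆ t, (A t - 2 * g t z) := by
    intro z
    refine ciSup_le fun t => ?_
    have h1 : A t + 2 * ∫ y, g t y ∂D ≤ ∫ y, ⨆ t, (A t + 2 * g t y) ∂D := by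
      have ig := (integrable_of_abs_le (μ := D) (hg t) (hgM t)).const_mul 2
      calc A t + 2 * ∫ y, g t y ∂D = ∫ y, (A t + 2 * g t y) ∂D := by
            rw [integral_add (integrable_const _) ig, integral_const_mul]
            simp
        _ ≤ _ := integral_mono ((integrable_const _).add ig) iplus fun y =>
            le_iSup_of_finite (fun t => A t + 2 * g t y) t
    have h2 := le_iSup_of_finite (fun t => A t - 2 * g t z) t
    linarith
  calc ∫ z, ⨆ t, (A t + ((∫ y, g t y ∂D) - g t z)) ∂D
      ≤ ∫ z, (2⁻¹ * (∫ y, ⨆ t, (A t + 2 * g t y) ∂D) + 2⁻¹ * ⨆ t, (A t - 2 * g t z)) ∂D :=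
        integral_mono (integrable_of_abs_le hcent hcentb)
          ((integrable_const _).add (iminus.const_mul _)) hpt
    _ = 2⁻¹ * ∫ z, ((⨆ t, (A t + 2 * g t z)) + ⨆ t, (A t - 2 * g t z)) ∂D := by
        rw [integral_add (integrable_const _) (iminus.const_mul _), integral_add iplus iminus,
          integral_const_mul, integral_const_mul]
        simp
        ring
    _ ≤ 2⁻¹ * ∫ z, (K : ℝ)⁻¹ * ∑ k, ((⨆ t, (A t + 2 * l * K * v t z k)) +
          ⨆ t, (A t - 2 * l * K * v t z k)) ∂D := by
        refine mul_le_mul_of_nonneg_left (integral_mono (iplus.add iminus) ?_ fun z =>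
          iSup_add_iSup_le_sum (Nat.pos_of_ne_zero (NeZero.ne K)) A (fun t => g t z)
            (fun t => v t z) hl (hlip z)) (by norm_num)
        refine Integrable.const_mul (integrable_finsetSum _ fun k _ => ?_) _
        have e1 : ∀ b, Integrable (fun z =>
            ⨆ t, (A t + boolSign b * (2 * l * K * v t z k))) D := fun b =>
          integrable_of_abs_le (hs.comp (measurable_prodMk_right (y := (k, b)))) fun z =>
            hsb (z, k, b)
        refine ((e1 true).add (e1 false)).congr (Filter.Eventually.of_forall fun z => ?_)
        simp [boolSign, sub_eq_add_neg]
    _ = _ := by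
        rw [← integral_const_mul]
        refine integral_congr_ae (Filter.Eventually.of_forall fun z => ?_)
        simp only [boolSign, sub_eq_add_neg, mul_inv, if_true, one_mul, Bool.false_eq_true, if_false,
          neg_mul, mul_assoc]

/-- The Rademacher bound for Lipschitz functions of bounded linear maps. -/
theorem integral_iSup_centered_sum_le (D : Measure Z) [IsProbabilityMeasure D] {K : ℕ} [NeZero K]
    {ι : Type*} [Fintype ι] {φ : Z → ι → ℝ} (hφ : ∀ a, Measurable fun z => φ z a)
    (hφ2 : ∀ z, ∑ a, φ z a ^ 2 ≤ 2) {Θ : T → Fin K → ι → ℝ} {B : ℝ} (hB : 0 ≤ B)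
    (hΘ : ∀ t, ∑ k, ∑ a, Θ t k a ^ 2 ≤ B ^ 2) {g : T → Z → ℝ} (hg : ∀ t, Measurable (g t)) {M : ℝ}
    (hgM : ∀ t z, |g t z| ≤ M) {l : ℝ} (hl : 0 < l)
    (hlip : ∀ z t t', ∃ k, |g t z - g t' z| ≤
      l * |∑ a, Θ t k a * φ z a - ∑ a, Θ t' k a * φ z a|) {N : ℕ} (hN : 0 < N) :
    ∫ s, ⨆ t, ∑ i, ((∫ y, g t y ∂D) - g t (s i)) ∂(Measure.pi fun _ : Fin N => D) ≤
      2 * l * K * B * Real.sqrt (2 * N) := by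
  have hK : (0 : ℝ) < K := by exact_mod_cast Nat.pos_of_ne_zero (NeZero.ne K)
  have hN' : (0 : ℝ) < N := by exact_mod_cast hN
  have hv : ∀ t k, Measurable fun z => ∑ a, Θ t k a * φ z a := fun t k =>
    Finset.measurable_sum _ fun a _ => (hφ a).const_mul _
  have hφb : ∀ z a, |φ z a| ≤ 2 := fun z a => by
    have := (Finset.single_le_sum (f := fun a => φ z a ^ 2) (fun a _ => sq_nonneg _)
      (Finset.mem_univ a)).trans (hφ2 z)
    exact abs_le_of_sq_le_sq (by linarith) (by norm_num)
  have hΘb : ∀ t k a, |Θ t k a| ≤ B := fun t k a => by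
    have h1 := Finset.single_le_sum (f := fun a => Θ t k a ^ 2) (fun a _ => sq_nonneg _)
      (Finset.mem_univ a)
    have h2 := Finset.single_le_sum (f := fun k => ∑ a, Θ t k a ^ 2)
      (fun k _ => Finset.sum_nonneg fun a _ => sq_nonneg _) (Finset.mem_univ k)
    exact abs_le_of_sq_le_sq ((h1.trans h2).trans (hΘ t)) hB
  have hvM : ∀ t z k, |∑ a, Θ t k a * φ z a| ≤ Fintype.card ι * (B * 2) := fun t z k => by
    refine (Finset.abs_sum_le_sum_abs _ _).trans ((Finset.sum_le_sum fun a _ => ?_).trans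
      (b := ∑ _a : ι, B * 2) ?_)
    · rw [abs_mul]
      exact mul_le_mul (hΘb t k a) (hφb z a) (abs_nonneg _) hB
    · simp
  set c : ℝ := 2 * l * K with hc
  have hc0 : 0 < c := by positivity
  -- One crude bound for all functions involved; it serves integrability only and does not enter the
  -- result.
  set M' : ℝ := max (2 * M) (max M (max (c * (Fintype.card ι * (B * 2)))
    (Fintype.card ι * (B * 2)))) with hM'
  -- the vector of signed features
  set ξ : Fin K → ι → Z × (Fin K × Bool) → ℝ := fun k a x =>
    boolSign x.2.2 * (c * if x.2.1 = k then φ x.1 a else 0) with hξ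
  have hξm : ∀ k a, Measurable (ξ k a) := fun k a => by
    refine measurable_from_prod_countable_left fun y => ?_
    simp only [hξ]
    refine Measurable.const_mul (Measurable.const_mul ?_ _) _
    split_ifs
    · exact hφ a
    · exact measurable_const
  have hξb : ∀ k a x, |ξ k a x| ≤ c * 2 := fun k a x => by
    simp only [hξ]
    rw [abs_mul, abs_boolSign, one_mul, abs_mul, abs_of_pos hc0]
    refine mul_le_mul_of_nonneg_left ?_ hc0.le
    split_ifs
    · exact hφb _ _
    · norm_num
  have hξ0 : ∀ k a, ∫ x, ξ k a x ∂(D.prod (signedCoord K)) = 0 := fun k a => by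
    rw [integral_prod_signedCoord D (hξm k a) (hξb k a)]
    have h0 : ∀ z k', ξ k a (z, k', true) + ξ k a (z, k', false) = 0 := fun z k' => by
      simp [hξ, boolSign, -mul_ite]
    simp [h0]
  -- Only the block of the drawn coordinate is nonzero, so the sum over `k` costs no second factor
  -- `K`.
  have hξs : ∀ x, ∑ k, ∑ a, ξ k a x ^ 2 ≤ 2 * c ^ 2 := fun x => by
    have : ∀ k a, ξ k a x ^ 2 = if x.2.1 = k then c ^ 2 * φ x.1 a ^ 2 else 0 := fun k a => by
      simp only [hξ]
      rw [mul_pow, boolSign_sq]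
      split_ifs <;> simp [mul_pow]
    simp only [this]
    rw [Finset.sum_comm]
    simp only [Finset.sum_ite_eq, Finset.mem_univ, if_true, ← Finset.mul_sum]
    nlinarith [hφ2 x.1, sq_nonneg c]
  have hξv : ∀ t x, boolSign x.2.2 * (c * ∑ a, Θ t x.2.1 a * φ x.1 a) =
      ∑ k, ∑ a, Θ t k a * ξ k a x := fun t x => by
    rw [Finset.sum_comm]
    simp only [hξ, mul_ite, mul_zero, Finset.sum_ite_eq, Finset.mem_univ, if_true, Finset.mul_sum]
    exact Finset.sum_congr rfl fun a _ => by ring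
  have hrep := integral_iSup_sum_le_of_forall D (D.prod (signedCoord K))
    (p := fun t z => (∫ y, g t y ∂D) - g t z)
    (h := fun t x => boolSign x.2.2 * (c * ∑ a, Θ t x.2.1 a * φ x.1 a)) (M := M')
    (fun t => measurable_const.sub (hg t))
    (fun t => measurable_from_prod_countable_left fun y =>
      ((hv t y.1).const_mul c).const_mul (boolSign y.2))
    (fun t z => ((abs_sub _ _).trans (add_le_add (abs_integral_le_of_abs_le (hgM t))
      (hgM t z))).trans (by rw [← two_mul]; exact le_max_left _ _))
    (fun t x => by
      rw [abs_mul, abs_boolSign, one_mul, abs_mul, abs_of_pos hc0]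
      exact (mul_le_mul_of_nonneg_left (hvM t x.1 x.2.1) hc0.le).trans
        ((le_max_left _ _).trans ((le_max_right _ _).trans (le_max_right _ _))))
    (integral_iSup_add_centered_le D (v := fun t z k => ∑ a, Θ t k a * φ z a) (M := M') hg hv
      (fun t z => (hgM t z).trans ((le_max_left _ _).trans (le_max_right _ _)))
      (fun t z k => (hvM t z k).trans
        ((le_max_right _ _).trans ((le_max_right _ _).trans (le_max_right _ _)))) hl.le hlip)
    N 0
  simp only [Pi.zero_apply, zero_add] at hrep
  refine hrep.trans ?_
  -- the sum of squares of the signed feature sums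
  set m : ℝ := c * Real.sqrt (2 * N) with hm
  have hm0 : 0 < m := by positivity
  have hm2 : m ^ 2 = 2 * c ^ 2 * N := by
    rw [hm, mul_pow, Real.sq_sqrt (by positivity)]
    ring
  set Q : (Fin N → Z × (Fin K × Bool)) → ℝ := fun s => ∑ k, ∑ a, (∑ i, ξ k a (s i)) ^ 2 with hQ
  have iξ2 : ∀ k a, Integrable (fun s : Fin N → Z × (Fin K × Bool) => (∑ i, ξ k a (s i)) ^ 2)
      (Measure.pi fun _ : Fin N => D.prod (signedCoord K)) := fun k a => by
    refine integrable_of_abs_le (M := (N * (c * 2)) ^ 2)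
      ((Finset.measurable_sum _ fun i _ => (hξm k a).comp (measurable_pi_apply i)).pow_const 2)
      fun s => ?_
    rw [abs_pow]
    refine pow_le_pow_left₀ (abs_nonneg _) ((Finset.abs_sum_le_sum_abs _ _).trans
      ((Finset.sum_le_sum fun i _ => hξb k a (s i)).trans ?_)) 2
    simp
  have iQ : Integrable Q (Measure.pi fun _ : Fin N => D.prod (signedCoord K)) :=
    integrable_finsetSum _ fun k _ => integrable_finsetSum _ fun a _ => iξ2 k a
  have hQint : ∫ s, Q s ∂(Measure.pi fun _ : Fin N => D.prod (signedCoord K)) ≤ m ^ 2 := by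
    have iξ : ∀ k a, Integrable (fun x => ξ k a x ^ 2) (D.prod (signedCoord K)) := fun k a => by
      refine integrable_of_abs_le (M := (c * 2) ^ 2) ((hξm k a).pow_const 2) fun x => ?_
      rw [abs_pow]
      exact pow_le_pow_left₀ (abs_nonneg _) (hξb k a x) 2
    have h1 : ∀ k a, ∫ s, (∑ i, ξ k a (s i)) ^ 2
        ∂(Measure.pi fun _ : Fin N => D.prod (signedCoord K)) =
        N * ∫ x, ξ k a x ^ 2 ∂(D.prod (signedCoord K)) := fun k a => by
      simpa using integral_sq_add_sum (D.prod (signedCoord K)) (hξm k a) (hξb k a) (hξ0 k a) N 0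
    rw [hQ, integral_finsetSum _ fun k _ => integrable_finsetSum _ fun a _ => iξ2 k a]
    simp_rw [integral_finsetSum _ fun a _ => iξ2 _ a, h1, ← Finset.mul_sum,
      ← integral_finsetSum _ fun a _ => iξ _ a]
    rw [← integral_finsetSum _ fun k _ => integrable_finsetSum _ fun a _ => iξ k a, hm2]
    have : ∫ x, ∑ k, ∑ a, ξ k a x ^ 2 ∂(D.prod (signedCoord K)) ≤ 2 * c ^ 2 := by
      refine (integral_mono (integrable_finsetSum _ fun k _ =>
        integrable_finsetSum _ fun a _ => iξ k a) (integrable_const (2 * c ^ 2)) hξs).trans ?_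
      simp
    nlinarith
  have hpt : ∀ s : Fin N → Z × (Fin K × Bool),
      ⨆ t, ∑ i, boolSign (s i).2.2 * (c * ∑ a, Θ t (s i).2.1 a * φ (s i).1 a) ≤
        B / 2 * (Q s / m + m) := by
    intro s
    refine ciSup_le fun t => ?_
    simp only [hξv]
    have h1 : ∑ i, ∑ k, ∑ a, Θ t k a * ξ k a (s i) =
        ∑ p : Fin K × ι, Θ t p.1 p.2 * ∑ i, ξ p.1 p.2 (s i) := by
      simp only [Finset.mul_sum, Fintype.sum_prod_type]
      rw [Finset.sum_comm]
      exact Finset.sum_congr rfl fun k _ => Finset.sum_comm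
    rw [h1]
    have hQ0 : 0 ≤ Q s := Finset.sum_nonneg fun k _ => Finset.sum_nonneg fun a _ => sq_nonneg _
    have h2 := Real.sum_mul_le_sqrt_mul_sqrt Finset.univ (fun p : Fin K × ι => Θ t p.1 p.2)
      (fun p => ∑ i, ξ p.1 p.2 (s i))
    have h3 : Real.sqrt (∑ p : Fin K × ι, Θ t p.1 p.2 ^ 2) ≤ B := by
      rw [Fintype.sum_prod_type]
      exact Real.sqrt_le_iff.2 ⟨hB, hΘ t⟩
    have h4 : ∑ p : Fin K × ι, (∑ i, ξ p.1 p.2 (s i)) ^ 2 = Q s := Fintype.sum_prod_type _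
    rw [h4] at h2
    -- The tangent of the square root at `m ^ 2`: it turns the bound `m ^ 2` for the mean of `Q`
    -- into the bound `m` for the mean of its root, in place of Jensen's inequality.
    have h5 : Real.sqrt (Q s) ≤ 1 / 2 * (Q s / m + m) := by
      have : Q s / m + m - 2 * Real.sqrt (Q s) = (Real.sqrt (Q s) - m) ^ 2 / m := by
        rw [sub_sq, Real.sq_sqrt hQ0]
        field_simp
        ring
      have h6 : 0 ≤ (Real.sqrt (Q s) - m) ^ 2 / m := by positivity
      linarith
    calc _ ≤ _ := h2
      _ ≤ B * (1 / 2 * (Q s / m + m)) := mul_le_mul h3 h5 (Real.sqrt_nonneg _) hB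
      _ = _ := by ring
  have iR : Integrable (fun s => B / 2 * (Q s / m + m))
      (Measure.pi fun _ : Fin N => D.prod (signedCoord K)) :=
    ((iQ.div_const m).add (integrable_const m)).const_mul _
  calc _ ≤ ∫ s, B / 2 * (Q s / m + m) ∂(Measure.pi fun _ : Fin N => D.prod (signedCoord K)) := by
        refine integral_mono (integrable_of_abs_le (M := 0 + N * M') ?_ fun s => ?_) iR hpt
        · simpa using measurable_iSup_add_sum (q := fun t (x : Z × (Fin K × Bool)) =>
            boolSign x.2.2 * (c * ∑ a, Θ t x.2.1 a * φ x.1 a))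
            (fun t => measurable_from_prod_countable_left fun y =>
              ((hv t y.1).const_mul c).const_mul (boolSign y.2)) 0 N
        · have := abs_iSup_add_sum_le (A := (0 : T → ℝ)) (q := fun t (x : Z × (Fin K × Bool)) =>
            boolSign x.2.2 * (c * ∑ a, Θ t x.2.1 a * φ x.1 a)) (C := 0) (M := M') s (by simp)
            (fun t x => by
              rw [abs_mul, abs_boolSign, one_mul, abs_mul, abs_of_pos hc0]
              exact (mul_le_mul_of_nonneg_left (hvM t x.1 x.2.1) hc0.le).trans
                ((le_max_left _ _).trans ((le_max_right _ _).trans (le_max_right _ _))))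
          simpa using this
    _ = B / 2 * ((∫ s, Q s ∂(Measure.pi fun _ : Fin N => D.prod (signedCoord K))) / m + m) := by
        rw [integral_const_mul, integral_add (iQ.div_const m) (integrable_const m),
          integral_div]
        simp
    _ ≤ B / 2 * (m ^ 2 / m + m) := by gcongr
    _ = c * B * Real.sqrt (2 * N) := by
        rw [pow_two, mul_div_assoc, div_self hm0.ne', hm]
        ring

end Symmetrization

/-! ### A margin bound for bounded linear classes -/

theorem abs_clamp_sub_clamp_le (x y : ℝ) :
    |max 0 (min 1 x) - max 0 (min 1 y)| ≤ |x - y| := by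
  refine (abs_max_sub_max_le_max _ _ _ _).trans (max_le (by simp) ?_)
  refine (abs_min_sub_min_le_max _ _ _ _).trans (max_le (by simp) le_rfl)

/-- The ramp loss of the scores `v` for the label `y`: it is `1` for margins below `γ / 4` and
vanishes for margins above `3 γ / 4`. -/
def rampLoss {K : ℕ} (γ : ℝ) (y : Fin K) (v : Fin K → ℝ) : ℝ :=
  ⨆ k, if k = y then 0 else max 0 (min 1 (3 / 2 - 2 / γ * (v y - v k)))

section rampLoss

variable {K : ℕ} {γ : ℝ} (y : Fin K) (v : Fin K → ℝ)

/-- The entry `0` at `k = y` forces this. It also makes the loss vanish for a single class, in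
agreement with the convention `max ∅ = -∞`. -/
theorem rampLoss_nonneg : 0 ≤ rampLoss γ y v := by
  have := le_iSup_of_finite
    (fun k => if k = y then 0 else max 0 (min 1 (3 / 2 - 2 / γ * (v y - v k)))) y
  simpa [rampLoss] using this

theorem rampLoss_le_one : rampLoss γ y v ≤ 1 := by
  have : Nonempty (Fin K) := ⟨y⟩
  refine ciSup_le fun k => ?_
  split_ifs
  · exact zero_le_one
  · exact max_le zero_le_one (min_le_left _ _)

theorem abs_rampLoss_le : |rampLoss γ y v| ≤ 1 := by
  rw [abs_of_nonneg (rampLoss_nonneg y v)]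
  exact rampLoss_le_one y v

variable {y v}

theorem one_le_rampLoss (hγ : 0 < γ) {k : Fin K} (hk : k ≠ y) (h : v y ≤ γ / 4 + v k) :
    1 ≤ rampLoss γ y v := by
  refine le_trans ?_ (le_iSup_of_finite
    (fun k => if k = y then 0 else max 0 (min 1 (3 / 2 - 2 / γ * (v y - v k)))) k)
  simp only [if_neg hk]
  refine le_max_of_le_right (le_min le_rfl ?_)
  have : 2 / γ * (v y - v k) ≤ 2 / γ * (γ / 4) := by
    gcongr
    linarith
  have h2 : 2 / γ * (γ / 4) = 1 / 2 := by
    field_simp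
    norm_num
  linarith

theorem rampLoss_eq_zero (hγ : 0 < γ) (h : ∀ k, k ≠ y → 3 * γ / 4 + v k ≤ v y) :
    rampLoss γ y v = 0 := by
  refine le_antisymm ?_ (rampLoss_nonneg y v)
  have : Nonempty (Fin K) := ⟨y⟩
  refine ciSup_le fun k => ?_
  split_ifs with hk
  · exact le_rfl
  · refine max_le le_rfl (min_le_of_right_le ?_)
    have : 2 / γ * (3 * γ / 4) ≤ 2 / γ * (v y - v k) := by
      gcongr
      linarith [h k hk]
    have h2 : 2 / γ * (3 * γ / 4) = 3 / 2 := by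
      field_simp
      norm_num
    linarith

variable (y v)

/-- The ramp has slope `2 / γ` and a margin involves two scores, whence `4 / γ`. The witness is the
coordinate that moves most; the existential form is the one used by the contraction step. -/
theorem exists_abs_rampLoss_sub_le (hγ : 0 < γ) (v' : Fin K → ℝ) :
    ∃ k, |rampLoss γ y v - rampLoss γ y v'| ≤ 4 / γ * |v k - v' k| := by
  have : Nonempty (Fin K) := ⟨y⟩
  obtain ⟨k₀, hk₀⟩ := Finite.exists_max fun k => |v k - v' k|
  refine ⟨k₀, abs_iSup_sub_iSup_le fun k => ?_⟩
  split_ifs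
  · simp only [sub_self, abs_zero]
    positivity
  · refine (abs_clamp_sub_clamp_le _ _).trans ?_
    have h1 : 3 / 2 - 2 / γ * (v y - v k) - (3 / 2 - 2 / γ * (v' y - v' k)) =
        2 / γ * ((v k - v' k) - (v y - v' y)) := by ring
    rw [h1, abs_mul, abs_of_pos (by positivity)]
    calc 2 / γ * |v k - v' k - (v y - v' y)| ≤ 2 / γ * (|v k₀ - v' k₀| + |v k₀ - v' k₀|) := by
          gcongr
          exact (abs_sub _ _).trans (add_le_add (hk₀ k) (hk₀ y))
      _ = 4 / γ * |v k₀ - v' k₀| := by ring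

end rampLoss

theorem measurable_rampLoss {X : Type*} [MeasurableSpace X] {K : ℕ} {γ : ℝ} {f : X → Fin K → ℝ}
    (hf : ∀ k, Measurable fun x => f x k) :
    Measurable fun z : X × Fin K => rampLoss γ z.2 (f z.1) := by
  refine measurable_from_prod_countable_left fun y => Measurable.iSup fun k => ?_
  dsimp only
  split_ifs
  · exact measurable_const
  · exact measurable_const.max (measurable_const.min
      (measurable_const.sub (((hf y).sub (hf k)).const_mul _)))

/-- A finite subclass makes the supremum of deviations measurable. The cardinality of the net never
enters the bounds, so total boundedness is enough. -/
theorem exists_finite_net {K : ℕ} {ι : Type*} [Fintype ι] {B : ℝ} {ε : ℝ} (hε : 0 < ε) :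
    ∃ S : Set (Fin K → ι → ℝ), S.Finite ∧ (∀ Θ ∈ S, ∑ k, ∑ a, Θ k a ^ 2 ≤ B ^ 2) ∧
      ∀ Θ : Fin K → ι → ℝ, ∑ k, ∑ a, Θ k a ^ 2 ≤ B ^ 2 →
        ∃ Θ' ∈ S, ∀ k a, |Θ k a - Θ' k a| < ε := by
  have htb : TotallyBounded {Θ : Fin K → ι → ℝ | ∑ k, ∑ a, Θ k a ^ 2 ≤ B ^ 2} := by
    refine (isCompact_closedBall (0 : Fin K → ι → ℝ) |B|).totallyBounded.subset fun Θ hΘ => ?_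
    rw [mem_closedBall_zero_iff, pi_norm_le_iff_of_nonneg (abs_nonneg _)]
    intro k
    rw [pi_norm_le_iff_of_nonneg (abs_nonneg _)]
    intro a
    rw [Real.norm_eq_abs, ← sq_le_sq]
    have h1 := Finset.single_le_sum (f := fun a => Θ k a ^ 2) (fun a _ => sq_nonneg _)
      (Finset.mem_univ a)
    have h2 := Finset.single_le_sum (f := fun k => ∑ a, Θ k a ^ 2)
      (fun k _ => Finset.sum_nonneg fun a _ => sq_nonneg _) (Finset.mem_univ k)
    exact (h1.trans h2).trans hΘ
  obtain ⟨S, hS, hfin, hcov⟩ := Metric.finite_approx_of_totallyBounded htb ε hε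
  refine ⟨S, hfin, fun Θ hΘ => hS hΘ, fun Θ hΘ => ?_⟩
  obtain ⟨Θ', hΘ', hd⟩ := Set.mem_iUnion₂.1 (hcov hΘ)
  refine ⟨Θ', hΘ', fun k a => ?_⟩
  rw [← Real.dist_eq]
  exact ((dist_le_pi_dist _ _ a).trans (dist_le_pi_dist Θ Θ' k)).trans_lt hd

/-- Moving each score by `γ / 8` moves a margin by at most `γ / 4`, so nonpositive margins of `f`
land where the ramp equals `1`. -/
theorem expectedLoss_le_integral_rampLoss {X : Type*} [MeasurableSpace X] {K : ℕ}
    (D : Measure (X × Fin K)) [IsProbabilityMeasure D] {γ : ℝ} (hγ : 0 < γ) {f f' : X → Fin K → ℝ}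
    (hf' : ∀ k, Measurable fun x => f' x k) (hff' : ∀ x k, |f x k - f' x k| ≤ γ / 8) :
    expectedLoss D f 0 ≤ ∫ z, rampLoss γ z.2 (f' z.1) ∂D := by
  have hm := measurable_rampLoss (γ := γ) hf'
  have hmarkov := mul_meas_ge_le_integral_of_nonneg (μ := D)
    (f := fun z => rampLoss γ z.2 (f' z.1))
    (Filter.Eventually.of_forall fun z => rampLoss_nonneg _ _)
    (integrable_of_abs_le hm fun z => abs_rampLoss_le _ _) 1
  rw [one_mul] at hmarkov
  refine le_trans (measureReal_mono fun z hz => ?_) hmarkov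
  obtain ⟨k, hk, hle⟩ := hz
  refine one_le_rampLoss hγ hk ?_
  have h1 := abs_le.1 (hff' z.1 z.2)
  have h2 := abs_le.1 (hff' z.1 k)
  linarith

/-- The counterpart at the upper end: margins of `f` above `γ` stay above `3 * γ / 4`, where the
ramp vanishes. -/
theorem sum_rampLoss_le_empiricalLoss {X : Type*} {K N : ℕ} (hN : 0 < N) {γ : ℝ} (hγ : 0 < γ)
    {f f' : X → Fin K → ℝ} (hff' : ∀ x k, |f x k - f' x k| ≤ γ / 8) (s : Fin N → X × Fin K) :
    ∑ i, rampLoss γ (s i).2 (f' (s i).1) ≤ N * empiricalLoss s f γ := by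
  classical
  have hN' : (N : ℝ) ≠ 0 := by exact_mod_cast hN.ne'
  rw [empiricalLoss, mul_div_cancel₀ _ hN']
  refine Finset.sum_le_sum fun i _ => ?_
  split_ifs with h
  · exact rampLoss_le_one _ _
  · refine (rampLoss_eq_zero hγ fun k hk => ?_).le
    have h0 : ¬ f (s i).1 (s i).2 ≤ γ + f (s i).1 k := fun h' => h ⟨k, hk, h'⟩
    have h1 := abs_le.1 (hff' (s i).1 (s i).2)
    have h2 := abs_le.1 (hff' (s i).1 k)
    linarith

/-- McDiarmid's inequality for the largest deviation of the ramp loss over a net, whose mean is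
controlled by `integral_iSup_centered_sum_le`. The ramp lies between the two margin losses with room
for the discretization error. -/
theorem measure_exists_linear_margin_le {X : Type*} [MeasurableSpace X] {K : ℕ}
    (D : Measure (X × Fin K)) [IsProbabilityMeasure D] {ι : Type*} [Fintype ι] {φ : X → ι → ℝ}
    (hφ : ∀ a, Measurable fun x => φ x a) (hφ2 : ∀ x, ∑ a, φ x a ^ 2 ≤ 2) {N : ℕ} (hN : 0 < N)
    {γ B δ : ℝ} (hγ : 0 < γ) (hB : 0 ≤ B) (hδ : 0 < δ) (hδ1 : δ ≤ 1) :
    (Measure.pi fun _ : Fin N => D)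
      {s | ∃ Θ : Fin K → ι → ℝ, ∑ k, ∑ a, Θ k a ^ 2 ≤ B ^ 2 ∧
        ¬ expectedLoss D (fun x k => ∑ a, Θ k a * φ x a) 0 ≤
          empiricalLoss s (fun x k => ∑ a, Θ k a * φ x a) γ +
            (2 * (4 / γ) * K * B * Real.sqrt (2 * N) + Real.sqrt (2 * N * Real.log (1 / δ))) / N}
      ≤ ENNReal.ofReal δ := by
  have hN' : (0 : ℝ) < N := by exact_mod_cast hN
  have : NeZero K := ⟨by
    obtain ⟨z⟩ : Nonempty (X × Fin K) := D.nonempty_of_neZero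
    exact (Fin.pos z.2).ne'⟩
  -- Since `|φ x a| ≤ 2`, coefficients that differ by `ε` give scores that differ by at most `2 * ε
  -- * card ι ≤ γ / 8`; the `+ 1` keeps the denominator positive.
  set ε : ℝ := γ / 8 / (2 * Fintype.card ι + 1) with hε
  have hε0 : 0 < ε := by positivity
  obtain ⟨S, hfin, hS, hnet⟩ := exists_finite_net (K := K) (ι := ι) (B := B) hε0
  have : Fintype S := hfin.fintype
  have : Nonempty S := by
    obtain ⟨Θ, hΘ, -⟩ := hnet 0 (by simpa using sq_nonneg B)
    exact ⟨⟨Θ, hΘ⟩⟩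
  set f : S → X → Fin K → ℝ := fun t x k => ∑ a, t.1 k a * φ x a with hf
  have hfm : ∀ t k, Measurable fun x => f t x k := fun t k =>
    Finset.measurable_sum _ fun a _ => (hφ a).const_mul _
  set g : S → X × Fin K → ℝ := fun t z => rampLoss γ z.2 (f t z.1) with hg
  have hgm : ∀ t, Measurable (g t) := fun t => measurable_rampLoss (hfm t)
  have hgM : ∀ t z, |g t z| ≤ 1 := fun t z => abs_rampLoss_le _ _
  have hφb : ∀ x a, |φ x a| ≤ 2 := fun x a => by
    have := (Finset.single_le_sum (f := fun a => φ x a ^ 2) (fun a _ => sq_nonneg _)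
      (Finset.mem_univ a)).trans (hφ2 x)
    exact abs_le_of_sq_le_sq (by linarith) (by norm_num)
  set F : (Fin N → X × Fin K) → ℝ := fun s => ⨆ t, ∑ i, ((∫ z, g t z ∂D) - g t (s i)) with hF
  have hEF : ∫ s, F s ∂(Measure.pi fun _ : Fin N => D) ≤
      2 * (4 / γ) * K * B * Real.sqrt (2 * N) :=
    integral_iSup_centered_sum_le D (φ := fun z => φ z.1) (Θ := fun t => t.1)
      (fun a => (hφ a).comp measurable_fst) (fun z => hφ2 z.1) hB (fun t => hS _ t.2) hgm hgM
      (by positivity) (fun z t t' => exists_abs_rampLoss_sub_le _ _ hγ _) hN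
  have hFm : Measurable F := Measurable.iSup fun t => Finset.measurable_sum _ fun i _ =>
    measurable_const.sub ((hgm t).comp (measurable_pi_apply i))
  have hFb : ∀ s, |F s| ≤ N * 2 := fun s => abs_iSup_le fun t => by
    refine (Finset.abs_sum_le_sum_abs _ _).trans ((Finset.sum_le_sum fun i _ =>
      (abs_sub _ _).trans (add_le_add (abs_integral_le_of_abs_le (hgM t)) (hgM t (s i)))).trans ?_)
    simp only [Finset.sum_const, Finset.card_univ, Fintype.card_fin, nsmul_eq_mul]
    norm_num
  -- For each `t`, only one ramp value changes, and both its values lie in `[0, 1]`.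
  have hFd : ∀ s i z, |F (Function.update s i z) - F s| ≤ 1 := fun s i z =>
    abs_iSup_sub_iSup_le fun t => by
      have h1 : ∑ j, ((∫ z, g t z ∂D) - g t (Function.update s i z j)) -
          ∑ j, ((∫ z, g t z ∂D) - g t (s j)) = g t (s i) - g t z := by
        rw [← Finset.sum_sub_distrib, Finset.sum_eq_single i]
        · simp
        · intro j _ hj
          simp [Function.update_of_ne hj]
        · simp
      rw [h1]
      have a1 : 0 ≤ g t (s i) := rampLoss_nonneg _ _
      have a2 : g t (s i) ≤ 1 := rampLoss_le_one _ _
      have a3 : 0 ≤ g t z := rampLoss_nonneg _ _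
      have a4 : g t z ≤ 1 := rampLoss_le_one _ _
      rw [abs_le]
      constructor <;> linarith
  have hlog : 0 ≤ Real.log (1 / δ) := Real.log_nonneg (by rw [le_div_iff₀ hδ]; linarith)
  have hmc := measureReal_ge_le_of_bounded_differences D one_pos hN hFm hFb hFd
    (Real.sqrt_nonneg (2 * N * Real.log (1 / δ)))
  have hexp : Real.exp (-(Real.sqrt (2 * N * Real.log (1 / δ)) ^ 2 / (2 * (N * 1 ^ 2)))) = δ := by
    rw [Real.sq_sqrt (by positivity)]
    have : 2 * N * Real.log (1 / δ) / (2 * (N * 1 ^ 2)) = Real.log (1 / δ) := by field_simp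
    rw [this, one_div, Real.log_inv, neg_neg, Real.exp_log hδ]
  rw [hexp] at hmc
  refine le_trans (measure_mono fun s hs => ?_) (ENNReal.le_ofReal_iff_toReal_le
    (measure_ne_top _ _) hδ.le |>.2 hmc)
  obtain ⟨Θ, hΘ, hlt⟩ := hs
  obtain ⟨Θ', hΘ', hclose⟩ := hnet Θ hΘ
  have hff' : ∀ x k, |(∑ a, Θ k a * φ x a) - f ⟨Θ', hΘ'⟩ x k| ≤ γ / 8 := fun x k => by
    simp only [hf]
    rw [← Finset.sum_sub_distrib]
    refine (Finset.abs_sum_le_sum_abs _ _).trans ((Finset.sum_le_sum fun a _ =>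
      (?_ : _ ≤ ε * 2)).trans ?_)
    · rw [← sub_mul, abs_mul]
      exact mul_le_mul (hclose k a).le (hφb x a) (abs_nonneg _) hε0.le
    · rw [Finset.sum_const, nsmul_eq_mul, Finset.card_univ, hε, div_mul_eq_mul_div, mul_div_assoc',
        div_le_iff₀ (by positivity)]
      nlinarith
  have h1 := expectedLoss_le_integral_rampLoss D hγ (hfm ⟨Θ', hΘ'⟩) hff'
  have h2 := sum_rampLoss_le_empiricalLoss hN hγ hff' s
  have h3 := le_iSup_of_finite (fun t => ∑ i, ((∫ z, g t z ∂D) - g t (s i))) ⟨Θ', hΘ'⟩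
  simp only [Finset.sum_sub_distrib, Finset.sum_const, Finset.card_univ, Fintype.card_fin,
    nsmul_eq_mul] at h3
  simp only [Set.mem_ofPred_eq, hF, Finset.sum_sub_distrib, Finset.sum_const, Finset.card_univ,
    Fintype.card_fin, nsmul_eq_mul] at hEF ⊢
  rw [not_le, ← lt_sub_iff_add_lt', div_lt_iff₀ hN'] at hlt
  nlinarith [mul_le_mul_of_nonneg_left h1 hN'.le]

/-! ### Frobenius norms -/

section Frobenius

open scoped Matrix.Norms.Frobenius

variable {m n : Type*} [Fintype m] [Fintype n]

theorem frobenius_norm_sq (A : Matrix m n ℂ) : ‖A‖ ^ 2 = ∑ i, ∑ k, ‖A i k‖ ^ 2 := by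
  rw [Matrix.frobenius_norm_def, ← Real.sqrt_eq_rpow, Real.sq_sqrt]
  · simp
  · positivity

theorem frobenius_norm_sq_eq_trace (A : Matrix m n ℂ) : ‖A‖ ^ 2 = (Aᴴ * A).trace.re := by
  rw [frobenius_norm_sq, Finset.sum_comm]
  simp only [Matrix.trace, Matrix.diag_apply, Matrix.mul_apply, Matrix.conjTranspose_apply,
    Complex.re_sum]
  refine Finset.sum_congr rfl fun i _ => Finset.sum_congr rfl fun k _ => ?_
  rw [Complex.star_def, ← Complex.normSq_eq_conj_mul_self, Complex.ofReal_re,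
    Complex.normSq_eq_norm_sq]

theorem frobenius_norm_mul_of_conjTranspose_mul [DecidableEq m] {l : Type*} [Fintype l]
    {U : Matrix l m ℂ} (hU : Uᴴ * U = 1) (A : Matrix m n ℂ) : ‖U * A‖ = ‖A‖ := by
  refine (pow_left_inj₀ (norm_nonneg _) (norm_nonneg _) two_ne_zero).1 ?_
  rw [frobenius_norm_sq_eq_trace, frobenius_norm_sq_eq_trace, Matrix.conjTranspose_mul,
    Matrix.mul_assoc, ← Matrix.mul_assoc Uᴴ, hU, Matrix.one_mul]

theorem frobeniusNorm_eq {n : ℕ} (A : Matrix (Fin n) (Fin n) ℂ) : frobeniusNorm A = ‖A‖ := by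
  rw [frobeniusNorm, ← frobenius_norm_sq, Real.sqrt_sq (norm_nonneg _)]

/-- The `ℓ²` norm of the singular values is at most their `ℓ¹` norm. -/
theorem frobeniusNorm_le_traceNorm {n : ℕ} (A : Matrix (Fin n) (Fin n) ℂ) :
    frobeniusNorm A ≤ traceNorm A := by
  have hA := Matrix.posSemidef_conjTranspose_mul_self A
  have h0 : ∀ i, 0 ≤ hA.isHermitian.eigenvalues i := hA.eigenvalues_nonneg
  have ht : 0 ≤ traceNorm A := Finset.sum_nonneg fun i _ => Real.sqrt_nonneg _
  rw [frobeniusNorm_eq]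
  refine abs_le_of_sq_le_sq' ?_ ht |>.2
  rw [frobenius_norm_sq_eq_trace, hA.isHermitian.trace_eq_sum_eigenvalues]
  calc (∑ i, (hA.isHermitian.eigenvalues i : ℂ)).re
      = ∑ i, Real.sqrt (hA.isHermitian.eigenvalues i) ^ 2 := by
        rw [Complex.re_sum]
        exact Finset.sum_congr rfl fun i _ => (Real.sq_sqrt (h0 i)).symm
    _ ≤ _ := Finset.sum_sq_le_sq_sum_of_nonneg fun i _ => Real.sqrt_nonneg _

theorem IsDensityMatrix.sum_norm_sq_le {n : ℕ} {ρ : Matrix (Fin n) (Fin n) ℂ}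
    (h : IsDensityMatrix ρ) : ∑ i, ∑ k, ‖ρ i k‖ ^ 2 ≤ 1 := by
  obtain ⟨hp, ht⟩ := h
  have h0 : ∀ i, 0 ≤ hp.isHermitian.eigenvalues i := hp.eigenvalues_nonneg
  have hsum : ∑ i, hp.isHermitian.eigenvalues i = 1 := by
    have := hp.isHermitian.trace_eq_sum_eigenvalues
    rw [ht] at this
    have h2 := congrArg Complex.re this
    rw [Complex.re_sum] at h2
    simpa using h2.symm
  -- Nonnegativity of the principal `2 × 2` minors; for `i = k` the repeated index makes the minor
  -- zero. Summation then gives the square of the trace.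
  have hdet : ∀ i k, ‖ρ i k‖ ^ 2 ≤ (ρ i i).re * (ρ k k).re := by
    intro i k
    have hs := (hp.submatrix ![i, k]).det_nonneg
    rw [Matrix.det_fin_two] at hs
    simp only [Matrix.submatrix_apply, Matrix.cons_val_zero, Matrix.cons_val_one] at hs
    have hki : ρ k i = star (ρ i k) := (hp.isHermitian.apply k i).symm
    have hre := (Complex.le_def.1 hs).1
    have hii := (Complex.le_def.1 (hp.diag_nonneg (i := i))).2
    have hkk := (Complex.le_def.1 (hp.diag_nonneg (i := k))).2
    rw [hki, Complex.star_def, Complex.mul_conj, Complex.sub_re, Complex.mul_re,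
      Complex.ofReal_re, Complex.normSq_eq_norm_sq] at hre
    simp only [Complex.zero_re, Complex.zero_im] at hre hii hkk
    rw [← hii, ← hkk] at hre
    linarith
  calc ∑ i, ∑ k, ‖ρ i k‖ ^ 2 ≤ ∑ i, ∑ k, (ρ i i).re * (ρ k k).re :=
        Finset.sum_le_sum fun i _ => Finset.sum_le_sum fun k _ => hdet i k
    _ = ρ.trace.re * ρ.trace.re := by
        simp only [Matrix.trace, Matrix.diag_apply, Complex.re_sum, Finset.sum_mul_sum]
    _ = 1 := by simp [ht]

end Frobenius

/-! ### The affine form of a layer -/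

section Layer

open scoped Matrix.Norms.Frobenius

/-- The matrix of the linear map with Choi operator `J`. -/
def choiTransfer {a b : ℕ} (J : Matrix (Fin a × Fin b) (Fin a × Fin b) ℂ) :
    Matrix (Fin b × Fin b) (Fin a × Fin a) ℂ :=
  Matrix.of fun p q => J (q.1, p.1) (q.2, p.2)

theorem ofChoi_apply_eq_mulVec {a b : ℕ} (J : Matrix (Fin a × Fin b) (Fin a × Fin b) ℂ)
    (ρ : Matrix (Fin a) (Fin a) ℂ) (k l : Fin b) :
    ofChoi J ρ k l = (choiTransfer J *ᵥ fun p => ρ p.1 p.2) (k, l) := by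
  simp [ofChoi, choiTransfer, Matrix.mulVec, dotProduct, Fintype.sum_prod_type, mul_comm]

/-- Reshuffling permutes matrix entries, so the Frobenius norm of the weights controls the layer as
a linear map on vectorized states. -/
theorem frobenius_norm_choiTransfer {a b : ℕ} (J : Matrix (Fin a × Fin b) (Fin a × Fin b) ℂ) :
    ‖choiTransfer J‖ = ‖J‖ := by
  refine (pow_left_inj₀ (norm_nonneg _) (norm_nonneg _) two_ne_zero).1 ?_
  simp only [frobenius_norm_sq, choiTransfer, Matrix.of_apply, Fintype.sum_prod_type]
  calc ∑ k, ∑ l, ∑ i, ∑ j, ‖J (i, k) (j, l)‖ ^ 2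
      = ∑ k, ∑ i, ∑ l, ∑ j, ‖J (i, k) (j, l)‖ ^ 2 :=
        Finset.sum_congr rfl fun _ _ => Finset.sum_comm
    _ = ∑ i, ∑ k, ∑ l, ∑ j, ‖J (i, k) (j, l)‖ ^ 2 := Finset.sum_comm
    _ = _ := Finset.sum_congr rfl fun _ _ => Finset.sum_congr rfl fun _ _ => Finset.sum_comm

namespace IsotypicDecomposition

variable {G : Type*} [Group G] [TopologicalSpace G] {a b : ℕ}
  {Rin : G →ₜ* Matrix.unitaryGroup (Fin a) ℂ} {Rout : G →ₜ* Matrix.unitaryGroup (Fin b) ℂ}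
  (I : IsotypicDecomposition Rin Rout)

/-- The part of the Choi operator that depends on the parameters. -/
def weightOp (W : I.Weights) : Matrix (Fin a × Fin b) (Fin a × Fin b) ℂ :=
  I.basis * (Matrix.blockDiagonal' fun μ =>
    (1 : Matrix (Fin (I.irrepDim μ)) (Fin (I.irrepDim μ)) ℂ) ⊗ₖ W μ) * I.basisᴴ

/-- Scalar blocks stay scalar under a unitary change of basis. The scalar part is the completely
depolarizing channel, hence constant on states. -/
theorem choiOp_eq (W : I.Weights) : I.choiOp W = (b : ℂ)⁻¹ • 1 + I.weightOp W := by
  have h : (Matrix.blockDiagonal' fun μ =>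
      (1 : Matrix (Fin (I.irrepDim μ)) (Fin (I.irrepDim μ)) ℂ) ⊗ₖ
        ((b : ℂ)⁻¹ • (1 : Matrix (Fin (I.mult μ)) (Fin (I.mult μ)) ℂ) + W μ)) =
      (b : ℂ)⁻¹ • 1 + Matrix.blockDiagonal' fun μ =>
        (1 : Matrix (Fin (I.irrepDim μ)) (Fin (I.irrepDim μ)) ℂ) ⊗ₖ W μ := by
    rw [← Matrix.blockDiagonal'_one, ← Matrix.blockDiagonal'_smul, ← Matrix.blockDiagonal'_add]
    congr 1
    funext μ
    simp [Matrix.kronecker_add, Matrix.kronecker_smul]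
  rw [choiOp, weightOp, h, Matrix.mul_add, Matrix.add_mul, Matrix.mul_smul, Matrix.mul_one,
    Matrix.smul_mul, I.basis_mul_conjTranspose]

theorem layer_apply (W : I.Weights) (ρ : Matrix (Fin a) (Fin a) ℂ) (k l : Fin b) :
    I.layer W ρ k l = (b : ℂ)⁻¹ * ρ.trace * (1 : Matrix (Fin b) (Fin b) ℂ) k l +
      (choiTransfer (I.weightOp W) *ᵥ fun p => ρ p.1 p.2) (k, l) := by
  rw [← ofChoi_apply_eq_mulVec, layer, choiOp_eq]
  simp only [ofChoi, LinearMap.coe_mk, AddHom.coe_mk, Matrix.of_apply, Matrix.add_apply,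
    Matrix.smul_apply, mul_add, Finset.sum_add_distrib, smul_eq_mul]
  congr 1
  simp only [Matrix.one_apply, Prod.mk.injEq, Matrix.trace, Matrix.diag_apply, ite_and]
  by_cases hkl : k = l <;> simp [hkl, Finset.mul_sum, mul_comm]

/-- Unitary invariance; the tensor factor `1` on the irrep space repeats each block `d_λ` times,
which produces the weights in `eqNormF`. -/
theorem frobenius_norm_weightOp (W : I.Weights) : ‖I.weightOp W‖ = I.eqNormF W := by
  have h1 : ‖I.weightOp W‖ = ‖Matrix.blockDiagonal' fun μ =>
      (1 : Matrix (Fin (I.irrepDim μ)) (Fin (I.irrepDim μ)) ℂ) ⊗ₖ W μ‖ := by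
    rw [weightOp, Matrix.mul_assoc,
      frobenius_norm_mul_of_conjTranspose_mul I.conjTranspose_mul_basis,
      ← Matrix.frobenius_norm_conjTranspose, Matrix.conjTranspose_mul,
      Matrix.conjTranspose_conjTranspose,
      frobenius_norm_mul_of_conjTranspose_mul I.conjTranspose_mul_basis,
      Matrix.frobenius_norm_conjTranspose]
  rw [h1, eqNormF, eq_comm, Real.sqrt_eq_iff_mul_self_eq (Finset.sum_nonneg fun μ _ => by positivity)
    (norm_nonneg _), ← pow_two, frobenius_norm_sq_eq_trace, Matrix.blockDiagonal'_conjTranspose,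
    ← Matrix.blockDiagonal'_mul, Matrix.trace_blockDiagonal', Complex.re_sum]
  refine Finset.sum_congr rfl fun μ _ => ?_
  rw [Matrix.conjTranspose_kronecker, ← Matrix.mul_kronecker_mul, Matrix.trace_kronecker,
    frobeniusNorm_eq, frobenius_norm_sq_eq_trace]
  simp

theorem eqNormF_nonneg (W : I.Weights) : 0 ≤ I.eqNormF W := Real.sqrt_nonneg _

/-- Blockwise from `d_λ ≤ d_λ ^ 2` and Frobenius below trace norm, then `ℓ²` below `ℓ¹` across
irreps. -/
theorem eqNormF_le_eqNorm1 (W : I.Weights) : I.eqNormF W ≤ I.eqNorm1 W := by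
  have hF : ∀ μ, 0 ≤ frobeniusNorm (W μ) := fun μ => Real.sqrt_nonneg _
  have hle : ∀ μ, (I.irrepDim μ : ℝ) * frobeniusNorm (W μ) ≤ I.irrepDim μ * traceNorm (W μ) :=
    fun μ => mul_le_mul_of_nonneg_left (frobeniusNorm_le_traceNorm _) (Nat.cast_nonneg _)
  refine le_trans ?_ (Finset.sum_le_sum fun μ _ => hle μ)
  rw [eqNormF, Real.sqrt_le_left (Finset.sum_nonneg fun μ _ => by have := hF μ; positivity)]
  refine le_trans (Finset.sum_le_sum fun μ _ => ?_)
    (Finset.sum_sq_le_sq_sum_of_nonneg fun μ _ => by have := hF μ; positivity)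
  rw [mul_pow]
  refine mul_le_mul_of_nonneg_right ?_ (sq_nonneg _)
  exact_mod_cast Nat.le_self_pow two_ne_zero _

theorem mul_eq_sum : a * b = ∑ μ, I.irrepDim μ * I.mult μ := by
  have h := (Matrix.toLin'OfInv I.basis_mul_conjTranspose I.conjTranspose_mul_basis).finrank_eq
  simpa [Module.finrank_fintype_fun_eq_card, eq_comm] using h

/-- The dimension count, with `m_λ ≤ m_λ ^ 2`. It lets the architecture constants absorb the number
of classes. -/
theorem mul_le : a * b ≤ I.maxIrrepDim * I.numParams := by
  rw [I.mul_eq_sum, numParams, Finset.mul_sum]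
  exact Finset.sum_le_sum fun μ _ => Nat.mul_le_mul
    (Finset.le_sup (f := I.irrepDim) (Finset.mem_univ μ)) (Nat.le_self_pow two_ne_zero _)

end IsotypicDecomposition

end Layer

/-! ### The affine form of a model -/

/-- Horner's recursion `β_(j+1) = 1 + c_j * β_j` for the analogue of `beta` on the first `j` layers.
-/
theorem sum_prod_filter_succ {L : ℕ} (c : Fin L → ℝ) {j : ℕ} (hj : j < L) :
    ∑ i : Fin L with i.val < j + 1, ∏ l : Fin L with i < l ∧ l.val < j + 1, c l =
      1 + c ⟨j, hj⟩ * ∑ i : Fin L with i.val < j, ∏ l : Fin L with i < l ∧ l.val < j, c l := by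
  have h1 : (Finset.univ.filter fun i : Fin L => i.val < j + 1) =
      insert ⟨j, hj⟩ (Finset.univ.filter fun i : Fin L => i.val < j) := by
    ext i
    simp only [Finset.mem_filter, Finset.mem_univ, true_and, Finset.mem_insert, Fin.ext_iff]
    omega
  rw [h1, Finset.sum_insert (by simp), Finset.mul_sum]
  congr 1
  · rw [Finset.filter_eq_empty_iff.2 fun l _ => by rw [Fin.lt_def]; simp only; omega,
      Finset.prod_empty]
  · refine Finset.sum_congr rfl fun i hi => ?_
    simp only [Finset.mem_filter, Finset.mem_univ, true_and] at hi
    have h2 : (Finset.univ.filter fun l : Fin L => i < l ∧ l.val < j + 1) =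
        insert ⟨j, hj⟩ (Finset.univ.filter fun l : Fin L => i < l ∧ l.val < j) := by
      ext l
      simp only [Finset.mem_filter, Finset.mem_univ, true_and, Finset.mem_insert, Fin.ext_iff,
        Fin.lt_def]
      omega
    rw [h2, Finset.prod_insert (by simp)]

theorem IsChannel.posSemidef {a b : ℕ} {Φ : Matrix (Fin a) (Fin a) ℂ →ₗ[ℂ] Matrix (Fin b) (Fin b) ℂ}
    (h : IsChannel Φ) {ρ : Matrix (Fin a) (Fin a) ℂ} (hρ : ρ.PosSemidef) : (Φ ρ).PosSemidef := by
  have h1 := h.completelyPositive 1 (ρ.submatrix Prod.snd Prod.snd) (hρ.submatrix _)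
  exact h1.submatrix fun k => (0, k)

namespace Architecture

open scoped Matrix.Norms.Frobenius

variable {G : Type*} [Group G] [TopologicalSpace G] {L : ℕ} (A : Architecture G L)

theorem state_succ (w : A.Params) (ρ : Matrix (Fin (A.dim 0)) (Fin (A.dim 0)) ℂ) (j : Fin L) :
    A.state w ρ j.succ = (A.iso j).layer (w j) (A.state w ρ j.castSucc) :=
  Fin.induction_succ _ _ _

variable {A}

theorem IsModel.isDensityMatrix_state {w : A.Params} (hw : A.IsModel w)
    {ρ : Matrix (Fin (A.dim 0)) (Fin (A.dim 0)) ℂ} (hρ : IsDensityMatrix ρ) (j : Fin (L + 1)) :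
    IsDensityMatrix (A.state w ρ j) := by
  induction j using Fin.induction with
  | zero => exact hρ
  | succ j ih =>
    rw [state_succ]
    exact ⟨(hw j).posSemidef ih.1, ((hw j).tracePreserving _).trans ih.2⟩

theorem IsModel.dim_pos {w : A.Params} (hw : A.IsModel w)
    {ρ : Matrix (Fin (A.dim 0)) (Fin (A.dim 0)) ℂ} (hρ : IsDensityMatrix ρ) (j : Fin (L + 1)) :
    0 < A.dim j := by
  refine Nat.pos_of_ne_zero fun h => ?_
  have ht := (hw.isDensityMatrix_state hρ j).2
  have : IsEmpty (Fin (A.dim j)) := by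
    rw [h]
    infer_instance
  rw [Matrix.trace_eq_zero_of_isEmpty] at ht
  exact zero_ne_one ht

/-- The affine features `(1, ρ)` of a state. -/
def stateFeatures {n : ℕ} (ρ : Matrix (Fin n) (Fin n) ℂ) : Option (Fin n × Fin n) → ℂ :=
  fun p => p.elim 1 fun p => ρ p.1 p.2

/-- This column holds the maximally mixed state, of Frobenius norm `n ^ (-1/2)`, or zero when `n =
0`. It feeds the constant part of a state into the next layer. -/
theorem frobenius_norm_column_le {n : ℕ} {κ : Type*} [Fintype κ] [DecidableEq κ] (o : κ) :
    ‖(Matrix.of fun (p : Fin n × Fin n) (q : κ) =>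
      if q = o then (n : ℂ)⁻¹ * (1 : Matrix (Fin n) (Fin n) ℂ) p.1 p.2 else 0)‖ ≤ 1 := by
  refine abs_le_of_sq_le_sq' ?_ zero_le_one |>.2
  rw [frobenius_norm_sq]
  have h1 : ∀ p : Fin n × Fin n, ∀ q : κ, ‖Matrix.of (fun (p : Fin n × Fin n) (q : κ) =>
      if q = o then (n : ℂ)⁻¹ * (1 : Matrix (Fin n) (Fin n) ℂ) p.1 p.2 else 0) p q‖ ^ 2 =
      if q = o then (if p.1 = p.2 then ((n : ℝ)⁻¹) ^ 2 else 0) else 0 := by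
    intro p q
    simp only [Matrix.of_apply, Matrix.one_apply]
    split_ifs <;> simp
  simp only [h1, Finset.sum_ite_eq', Finset.mem_univ, if_true, Fintype.sum_prod_type,
    Finset.sum_ite_eq, Finset.sum_const, Finset.card_univ, Fintype.card_fin, nsmul_eq_mul]
  rcases Nat.eq_zero_or_pos n with rfl | hn
  · simp
  · have hn' : (1 : ℝ) ≤ n := by exact_mod_cast hn
    rw [pow_two, ← mul_assoc, mul_inv_cancel₀ (by positivity), one_mul, one_pow]
    exact inv_le_one_of_one_le₀ hn'

theorem eqNormF_le_sqrt_sumSqNorm (w : A.Params) (j : Fin L) :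
    (A.iso j).eqNormF (w j) ≤ Real.sqrt (A.sumSqNorm w) := by
  refine Real.le_sqrt_of_sq_le ?_
  exact Finset.single_le_sum (f := fun j => (A.iso j).eqNormF (w j) ^ 2)
    (fun _ _ => sq_nonneg _) (Finset.mem_univ j)

theorem eqNorm1_nonneg (w : A.Params) (j : Fin L) : 0 ≤ (A.iso j).eqNorm1 (w j) :=
  ((A.iso j).eqNormF_nonneg _).trans ((A.iso j).eqNormF_le_eqNorm1 _)

/-- The state after `t` layers is the maximally mixed state up to a linear image of the affine
features of the input, whose coefficients have Frobenius norm at most `C`. -/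
def HasAffineForm (A : Architecture G L) (w : A.Params) (t : Fin (L + 1)) (C : ℝ) : Prop :=
  ∃ Y : Matrix (Fin (A.dim t) × Fin (A.dim t)) (Option (Fin (A.dim 0) × Fin (A.dim 0))) ℂ,
    ‖Y‖ ≤ C ∧ ∀ ρ, IsDensityMatrix ρ → ∀ k l, A.state w ρ t k l =
      (A.dim t : ℂ)⁻¹ * (1 : Matrix (Fin (A.dim t)) (Fin (A.dim t)) ℂ) k l +
        (Y *ᵥ stateFeatures ρ) (k, l)

/-- The induction starts after one layer: at depth `0` the coefficients would essentially be the
identity matrix, whose Frobenius norm grows with the input dimension. -/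
theorem IsModel.hasAffineForm_first {w : A.Params} (hw : A.IsModel w) (hL : 0 < L) :
    A.HasAffineForm w (Fin.succ ⟨0, hL⟩) ((A.iso ⟨0, hL⟩).eqNormF (w ⟨0, hL⟩)) := by
  set J := choiTransfer ((A.iso ⟨0, hL⟩).weightOp (w ⟨0, hL⟩)) with hJ
  refine ⟨Matrix.of fun p q => q.elim 0 fun q => J p q, le_of_eq ?_, fun ρ hρ k l => ?_⟩
  · rw [← IsotypicDecomposition.frobenius_norm_weightOp, ← frobenius_norm_choiTransfer, ← hJ]
    refine (pow_left_inj₀ (norm_nonneg _) (norm_nonneg _) two_ne_zero).1 ?_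
    rw [frobenius_norm_sq, frobenius_norm_sq]
    simp only [Matrix.of_apply, Fintype.sum_option, Option.elim, norm_zero]
    simp
    rfl
  · rw [state_succ, IsotypicDecomposition.layer_apply, ← hJ]
    have ht : (A.state w ρ (Fin.castSucc ⟨0, hL⟩)).trace = 1 :=
      (hw.isDensityMatrix_state hρ _).2
    rw [ht, mul_one]
    congr 1
    simp [Matrix.mulVec, dotProduct, Fintype.sum_option, stateFeatures]
    rfl

/-- The incoming state is `E + Y` applied to the features, with `E` the maximally mixed part of norm
at most `1`; the Frobenius norm is submultiplicative. -/
theorem IsModel.hasAffineForm_succ {w : A.Params} (hw : A.IsModel w) {j : Fin L} {C : ℝ}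
    (h : A.HasAffineForm w j.castSucc C) :
    A.HasAffineForm w j.succ ((A.iso j).eqNormF (w j) * (1 + C)) := by
  obtain ⟨Y, hY, hstate⟩ := h
  set J := choiTransfer ((A.iso j).weightOp (w j)) with hJ
  set E : Matrix (Fin (A.dim j.castSucc) × Fin (A.dim j.castSucc))
      (Option (Fin (A.dim 0) × Fin (A.dim 0))) ℂ := Matrix.of fun p q =>
    if q = none then (A.dim j.castSucc : ℂ)⁻¹ *
      (1 : Matrix (Fin (A.dim j.castSucc)) (Fin (A.dim j.castSucc)) ℂ) p.1 p.2 else 0 with hE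
  refine ⟨J * (E + Y), ?_, fun ρ hρ k l => ?_⟩
  · have hJn : ‖J‖ = (A.iso j).eqNormF (w j) := by
      rw [hJ, frobenius_norm_choiTransfer, IsotypicDecomposition.frobenius_norm_weightOp]
    have hEn : ‖E‖ ≤ 1 := frobenius_norm_column_le none
    rw [← hJn]
    refine (Matrix.frobenius_norm_mul _ _).trans ?_
    exact mul_le_mul_of_nonneg_left ((norm_add_le E Y).trans (add_le_add hEn hY)) (norm_nonneg _)
  · rw [state_succ, IsotypicDecomposition.layer_apply, ← hJ,
      (hw.isDensityMatrix_state hρ _).2, mul_one, ← Matrix.mulVec_mulVec]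
    congr 3
    funext p
    refine (hstate ρ hρ p.1 p.2).trans ?_
    rw [Matrix.add_mulVec, Pi.add_apply]
    congr 1
    simp [hE, Matrix.mulVec, dotProduct, stateFeatures]

theorem HasAffineForm.mono {w : A.Params} {t : Fin (L + 1)} {C C' : ℝ}
    (h : A.HasAffineForm w t C) (hC : C ≤ C') : A.HasAffineForm w t C' := by
  obtain ⟨Y, hY, hstate⟩ := h
  exact ⟨Y, hY.trans hC, hstate⟩

/-- The factor `eqNormF` in front of `1 + C` is estimated in two ways: by `√sumSqNorm` on the term
`1`, and by `eqNorm1` on the accumulated term. This gives Horner's recursion times `√sumSqNorm`. -/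
theorem IsModel.hasAffineForm {w : A.Params} (hw : A.IsModel w) (j : ℕ) (hj : j < L) :
    A.HasAffineForm w (Fin.succ ⟨j, hj⟩) (Real.sqrt (A.sumSqNorm w) *
      ∑ i : Fin L with i.val < j + 1,
        ∏ l : Fin L with i < l ∧ l.val < j + 1, (A.iso l).eqNorm1 (w l)) := by
  induction j with
  | zero =>
    refine (hw.hasAffineForm_first hj).mono ?_
    rw [sum_prod_filter_succ _ hj]
    simpa using eqNormF_le_sqrt_sumSqNorm w ⟨0, hj⟩
  | succ j ih =>
    refine (hw.hasAffineForm_succ (j := ⟨j + 1, hj⟩) (ih (by omega))).mono ?_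
    rw [sum_prod_filter_succ _ hj]
    have h1 := eqNormF_le_sqrt_sumSqNorm w ⟨j + 1, hj⟩
    have h2 := (A.iso ⟨j + 1, hj⟩).eqNormF_le_eqNorm1 (w ⟨j + 1, hj⟩)
    set β := ∑ i : Fin L with i.val < j + 1,
      ∏ l : Fin L with i < l ∧ l.val < j + 1, (A.iso l).eqNorm1 (w l) with hβ
    have hβ0 : 0 ≤ β := Finset.sum_nonneg fun i _ => Finset.prod_nonneg fun l _ =>
      eqNorm1_nonneg w l
    have h3 := mul_le_mul_of_nonneg_right h2 (mul_nonneg (Real.sqrt_nonneg (A.sumSqNorm w)) hβ0)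
    linarith

/-- The real coordinates of the affine features. -/
def realFeatures {n : ℕ} (ρ : Matrix (Fin n) (Fin n) ℂ) (p : Option (Fin n × Fin n) × Bool) : ℝ :=
  if p.2 then (stateFeatures ρ p.1).re else (stateFeatures ρ p.1).im

theorem sum_realFeatures_sq_le {n : ℕ} {ρ : Matrix (Fin n) (Fin n) ℂ} (hρ : IsDensityMatrix ρ) :
    ∑ p, realFeatures ρ p ^ 2 ≤ 2 := by
  have h : ∀ z : ℂ, z.re ^ 2 + z.im ^ 2 = ‖z‖ ^ 2 := fun z => by
    rw [← Complex.normSq_eq_norm_sq, Complex.normSq_apply]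
    ring
  have h1 := hρ.sum_norm_sq_le
  simp only [realFeatures, Fintype.sum_prod_type, Fintype.sum_bool, if_true, Bool.false_eq_true,
    if_false, h, Fintype.sum_option, stateFeatures, Option.elim]
  norm_num
  linarith

theorem measurable_realFeatures {X : Type*} [MeasurableSpace X] {n : ℕ}
    {ρ : X → Matrix (Fin n) (Fin n) ℂ} (hρ : ∀ i k, Measurable fun x => ρ x i k)
    (p : Option (Fin n × Fin n) × Bool) : Measurable fun x => realFeatures (ρ x) p := by
  have h : Measurable fun x => stateFeatures (ρ x) p.1 := by
    rcases p with ⟨_ | p, b⟩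
    · exact measurable_const
    · exact hρ _ _
  unfold realFeatures
  split_ifs
  · exact Complex.measurable_re.comp h
  · exact Complex.measurable_im.comp h

theorem output_eq (w : A.Params) {X : Type*} (ρ : X → Matrix (Fin (A.dim 0)) (Fin (A.dim 0)) ℂ)
    (x : X) (k : Fin A.numClasses) :
    A.output w ρ x k = (A.state w (ρ x) (Fin.last L) k k).re := by
  rw [output]
  congr 1
  simp [Matrix.trace, Matrix.diag_apply, Matrix.mul_apply, Matrix.single_apply, ite_and]

/-- The outputs of a model are, up to a constant, linear in the features of the encoded state. -/
theorem IsModel.exists_output_eq (hL : 0 < L) {w : A.Params} (hw : A.IsModel w) :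
    ∃ Θ : Fin A.numClasses → Option (Fin (A.dim 0) × Fin (A.dim 0)) × Bool → ℝ,
      ∑ k, ∑ p, Θ k p ^ 2 ≤ (A.beta w * Real.sqrt (A.sumSqNorm w)) ^ 2 ∧
      ∀ {X : Type*} (ρ : X → Matrix (Fin (A.dim 0)) (Fin (A.dim 0)) ℂ),
        (∀ x, IsDensityMatrix (ρ x)) → ∀ x k, A.output w ρ x k =
          (A.numClasses : ℝ)⁻¹ + ∑ p, Θ k p * realFeatures (ρ x) p := by
  obtain ⟨n, rfl⟩ : ∃ n, L = n + 1 := ⟨L - 1, by omega⟩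
  obtain ⟨Y, hY, hstate⟩ := hw.hasAffineForm n (Nat.lt_succ_self n)
  -- The real part of a product is `re * re - im * im`, hence the sign; only the rows of diagonal
  -- entries are measured.
  refine ⟨fun k p => if p.2 then (Y (k, k) p.1).re else -(Y (k, k) p.1).im, ?_, ?_⟩
  · have hbeta : ∑ i : Fin (n + 1) with i.val < n + 1,
        ∏ l : Fin (n + 1) with i < l ∧ l.val < n + 1, (A.iso l).eqNorm1 (w l) = A.beta w := by
      rw [beta, Finset.filter_true_of_mem fun i _ => i.2]
      refine Finset.sum_congr rfl fun i _ => Finset.prod_congr ?_ fun _ _ => rfl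
      ext l
      simp [Fin.is_le]
    rw [hbeta] at hY
    have h : ∀ z : ℂ, z.re ^ 2 + (-z.im) ^ 2 = ‖z‖ ^ 2 := fun z => by
      rw [← Complex.normSq_eq_norm_sq, Complex.normSq_apply]
      ring
    simp only [Fintype.sum_prod_type, Fintype.sum_bool, if_true, Bool.false_eq_true, if_false, h]
    rw [mul_comm (A.beta w)]
    refine le_trans ?_ (pow_le_pow_left₀ (norm_nonneg _) hY 2)
    rw [frobenius_norm_sq, Fintype.sum_prod_type]
    exact Finset.sum_le_sum fun k _ => Finset.single_le_sum
      (f := fun l => ∑ p, ‖Y (k, l) p‖ ^ 2) (fun _ _ => by positivity) (Finset.mem_univ k)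
  · intro X ρ hρ x k
    rw [output_eq]
    refine (congrArg Complex.re (hstate (ρ x) (hρ x) k k)).trans ?_
    rw [Complex.add_re]
    congr 1
    · rw [Matrix.one_apply_eq, mul_one, ← Complex.ofReal_natCast, ← Complex.ofReal_inv,
        Complex.ofReal_re]
      rfl
    · simp only [Matrix.mulVec, dotProduct, Complex.re_sum, Fintype.sum_prod_type,
        Fintype.sum_bool, realFeatures, if_true, Bool.false_eq_true, if_false]
      refine Finset.sum_congr rfl fun p _ => ?_
      rw [Complex.mul_re]
      ring

theorem IsModel.output_nonneg {w : A.Params} (hw : A.IsModel w) {X : Type*}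
    {ρ : X → Matrix (Fin (A.dim 0)) (Fin (A.dim 0)) ℂ} (hρ : ∀ x, IsDensityMatrix (ρ x)) (x : X)
    (k : Fin A.numClasses) : 0 ≤ A.output w ρ x k := by
  rw [output_eq]
  exact (Complex.le_def.1 ((hw.isDensityMatrix_state (hρ x) _).1.diag_nonneg (i := k))).1

theorem IsModel.output_le_one {w : A.Params} (hw : A.IsModel w) {X : Type*}
    {ρ : X → Matrix (Fin (A.dim 0)) (Fin (A.dim 0)) ℂ} (hρ : ∀ x, IsDensityMatrix (ρ x)) (x : X)
    (k : Fin A.numClasses) : A.output w ρ x k ≤ 1 := by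
  have ht := congrArg Complex.re (hw.isDensityMatrix_state (hρ x) (Fin.last L)).2
  simp only [Matrix.trace, Matrix.diag_apply, Complex.re_sum, Complex.one_re] at ht
  rw [← ht]
  have h := Finset.single_le_sum (f := fun k => A.output w ρ x k)
    (fun k _ => hw.output_nonneg hρ x k) (Finset.mem_univ k)
  simpa only [output_eq] using h

theorem IsModel.numClasses_le (hL : 0 < L) {w : A.Params} (hw : A.IsModel w)
    {ρ : Matrix (Fin (A.dim 0)) (Fin (A.dim 0)) ℂ} (hρ : IsDensityMatrix ρ) :
    A.numClasses ≤ A.maxIrrepDim * A.maxNumParams := by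
  obtain ⟨n, rfl⟩ : ∃ n, L = n + 1 := ⟨L - 1, by omega⟩
  have hpos := hw.dim_pos hρ (Fin.last n).castSucc
  calc A.numClasses ≤ A.dim (Fin.last n).castSucc * A.dim (Fin.last n).succ :=
        Nat.le_mul_of_pos_left _ hpos
    _ ≤ _ := (A.iso (Fin.last n)).mul_le
    _ ≤ _ := Nat.mul_le_mul
      (Finset.le_sup (f := fun j => (A.iso j).maxIrrepDim) (Finset.mem_univ _))
      (Finset.le_sup (f := fun j => (A.iso j).numParams) (Finset.mem_univ _))

end Architecture

/-! ### The regimes of the bound -/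

section Losses

variable {X : Type*} {K N : ℕ}

theorem marginError_const_add {f : X → Fin K → ℝ} (c γ : ℝ) (z : X × Fin K) :
    MarginError (fun x k => c + f x k) γ z ↔ MarginError f γ z := by
  refine exists_congr fun k => and_congr_right fun _ => ?_
  constructor <;> intro h <;> linarith

theorem expectedLoss_const_add [MeasurableSpace X] (D : Measure (X × Fin K)) {f : X → Fin K → ℝ}
    (c γ : ℝ) : expectedLoss D (fun x k => c + f x k) γ = expectedLoss D f γ := by
  simp only [expectedLoss, marginError_const_add]

theorem empiricalLoss_const_add (s : Fin N → X × Fin K) {f : X → Fin K → ℝ} (c γ : ℝ) :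
    empiricalLoss s (fun x k => c + f x k) γ = empiricalLoss s f γ := by
  classical
  unfold empiricalLoss
  congr 1
  exact Finset.sum_congr rfl fun i _ => if_congr (marginError_const_add c γ _) rfl rfl

theorem expectedLoss_le_one [MeasurableSpace X] (D : Measure (X × Fin K)) [IsProbabilityMeasure D]
    (f : X → Fin K → ℝ) (γ : ℝ) : expectedLoss D f γ ≤ 1 :=
  measureReal_le_one

theorem empiricalLoss_nonneg (s : Fin N → X × Fin K) (f : X → Fin K → ℝ) (γ : ℝ) :
    0 ≤ empiricalLoss s f γ := by
  classical
  exact div_nonneg (Finset.sum_nonneg fun i _ => by split_ifs <;> norm_num) (Nat.cast_nonneg _)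

/-- If no margin exceeds `γ`, every sample counts as an error and the empirical loss is `1`. With a
single class there are no errors at all and the expected loss is `0`. -/
theorem expectedLoss_le_empiricalLoss_of_le [MeasurableSpace X] (D : Measure (X × Fin K))
    [IsProbabilityMeasure D] (hN : 0 < N) {f : X → Fin K → ℝ} {γ : ℝ}
    (h : ∀ x y k, f x y ≤ γ + f x k) (s : Fin N → X × Fin K) :
    expectedLoss D f 0 ≤ empiricalLoss s f γ := by
  classical
  have hN' : (N : ℝ) ≠ 0 := by exact_mod_cast hN.ne'
  rcases subsingleton_or_nontrivial (Fin K) with hK | hK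
  · have h0 : {z : X × Fin K | MarginError f 0 z} = ∅ :=
      Set.eq_empty_of_forall_notMem fun z ⟨k, hk, _⟩ => hk (Subsingleton.elim _ _)
    rw [expectedLoss, h0, measureReal_empty]
    exact empiricalLoss_nonneg s f γ
  · refine (expectedLoss_le_one D f 0).trans (le_of_eq ?_)
    have h1 : ∀ z : X × Fin K, MarginError f γ z := fun z =>
      (exists_ne z.2).imp fun k hk => ⟨hk, h _ _ _⟩
    simp only [empiricalLoss, h1, if_true, Finset.sum_const, Finset.card_univ, Fintype.card_fin,
      nsmul_eq_mul, mul_one]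
    rw [div_self hN']

end Losses

/-! ### Estimates of the complexity term and the choice of a radius -/

namespace Architecture

variable {G : Type*} [Group G] [TopologicalSpace G] {L : ℕ} {A : Architecture G L}

theorem sumSqNorm_nonneg (w : A.Params) : 0 ≤ A.sumSqNorm w :=
  Finset.sum_nonneg fun _ _ => sq_nonneg _

theorem one_le_beta (hL : 0 < L) (w : A.Params) : 1 ≤ A.beta w := by
  obtain ⟨n, rfl⟩ : ∃ n, L = n + 1 := ⟨L - 1, by omega⟩
  have h := Finset.single_le_sum
    (f := fun j => ∏ l ∈ Finset.Ioi j, (A.iso l).eqNorm1 (w l))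
    (fun j _ => Finset.prod_nonneg fun l _ => eqNorm1_nonneg w l) (Finset.mem_univ (Fin.last n))
  have h0 : Finset.Ioi (Fin.last n) = ∅ := Finset.Ioi_eq_empty.2 isMax_top
  simpa [h0, beta] using h

theorem one_le_betaCap (hL : 0 < L) (w : A.Params) : 1 ≤ A.betaCap w := by
  have h := Finset.single_le_sum (f := fun k => ((A.eta w : ℝ≥0∞) *
      ((ENat.card G : ℝ≥0∞) * (A.maxNumParams : ℝ≥0∞)) ^ (1 / 2 : ℝ)) ^ k)
    (fun k _ => zero_le) (Finset.mem_range.2 hL)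
  simpa [betaCap] using h

/-- `betaCap` contains the summand `k = 0`, and the quotient is at least `1` by assumption. A
positive denominator keeps the minimum finite, so `toReal` does not collapse it to `0`. -/
theorem one_le_netSize (hL : 0 < L) {w : A.Params} {N : ℕ} {γ : ℝ}
    (h0 : 0 < Real.sqrt (A.sumSqNorm w)) (h : Real.sqrt (A.sumSqNorm w) ≤ γ * Real.sqrt N) :
    1 ≤ A.netSize w N γ := by
  have hS : ENNReal.ofReal (Real.sqrt (A.sumSqNorm w)) ≠ 0 := (ENNReal.ofReal_pos.2 h0).ne'
  have h1 : 1 ≤ ENNReal.ofReal (γ * Real.sqrt N) /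
      ENNReal.ofReal (Real.sqrt (A.sumSqNorm w)) := by
    rw [ENNReal.le_div_iff_mul_le (Or.inl hS) (Or.inl ENNReal.ofReal_ne_top), one_mul]
    exact ENNReal.ofReal_le_ofReal h
  have htop : min (ENNReal.ofReal (γ * Real.sqrt N) /
      ENNReal.ofReal (Real.sqrt (A.sumSqNorm w))) (A.betaCap w) ≠ ∞ :=
    ne_top_of_le_ne_top (ENNReal.div_ne_top ENNReal.ofReal_ne_top hS) (min_le_left _ _)
  have h2 := ENNReal.toReal_mono htop (le_min h1 (one_le_betaCap hL w))
  simpa [netSize] using h2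

/-- The left side is the price of a union bound over `N` radii; `L` and `netSize` only enlarge the
argument. -/
theorem log_le_posLog_netSize (hL : 0 < L) {w : A.Params} {N : ℕ} (hN : 0 < N) {γ δ : ℝ}
    (hδ : 0 < δ) (h0 : 0 < Real.sqrt (A.sumSqNorm w))
    (h : Real.sqrt (A.sumSqNorm w) ≤ γ * Real.sqrt N) :
    Real.log (N / δ) ≤ Real.posLog (N * L * A.netSize w N γ / δ) := by
  have hN' : (0 : ℝ) < N := by exact_mod_cast hN
  have hL' : (1 : ℝ) ≤ L := by exact_mod_cast hL
  have h1 := one_le_netSize hL h0 h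
  refine (Real.log_le_log (by positivity) ?_).trans (le_max_right _ _)
  gcongr
  rw [mul_assoc]
  exact le_mul_of_one_le_right hN'.le (one_le_mul_of_one_le_of_one_le hL' h1)

/-- Keep the largest summand and use `log 2 ≥ 1 / 2`. -/
theorem maxNumParams_le_log (hL : 0 < L) :
    (A.maxNumParams : ℝ) / 2 ≤ Real.log (∑ j : Fin L, (2 : ℝ) ^ (A.iso j).numParams) := by
  have : Nonempty (Fin L) := ⟨⟨0, hL⟩⟩
  obtain ⟨j, -, hj⟩ := Finset.exists_mem_eq_sup Finset.univ Finset.univ_nonempty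
    fun j => (A.iso j).numParams
  have h1 : (2 : ℝ) ^ A.maxNumParams ≤ ∑ j : Fin L, (2 : ℝ) ^ (A.iso j).numParams := by
    rw [maxNumParams, hj]
    exact Finset.single_le_sum (f := fun j => (2 : ℝ) ^ (A.iso j).numParams)
      (fun _ _ => by positivity) (Finset.mem_univ j)
  refine le_trans ?_ (Real.log_le_log (by positivity) h1)
  rw [Real.log_pow]
  have := Real.log_two_gt_d9
  have h2 : (0 : ℝ) ≤ A.maxNumParams := Nat.cast_nonneg _
  nlinarith

/-- Pays for the factor `K` from contraction: of the `Ξ_max ^ 2` in `(d_max * Ξ_max) ^ 2`, one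
factor is kept and the other traded for twice the logarithm. -/
theorem sq_numClasses_mul_le (hL : 0 < L) (w : A.Params)
    (hK : A.numClasses ≤ A.maxIrrepDim * A.maxNumParams) :
    (A.numClasses * (A.beta w * Real.sqrt (A.sumSqNorm w))) ^ 2 / 2 ≤
      (A.maxIrrepDim : ℝ) ^ 2 * A.maxNumParams *
        Real.log (∑ j : Fin L, (2 : ℝ) ^ (A.iso j).numParams) * A.beta w ^ 2 *
          A.sumSqNorm w := by
  have hS := sumSqNorm_nonneg w
  have hK' : (A.numClasses : ℝ) ≤ A.maxIrrepDim * A.maxNumParams := by exact_mod_cast hK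
  have hlog := maxNumParams_le_log (A := A) hL
  have h1 : (A.numClasses : ℝ) ^ 2 / 2 ≤ (A.maxIrrepDim : ℝ) ^ 2 * A.maxNumParams *
      Real.log (∑ j : Fin L, (2 : ℝ) ^ (A.iso j).numParams) := by
    calc (A.numClasses : ℝ) ^ 2 / 2 ≤ (A.maxIrrepDim * A.maxNumParams : ℝ) ^ 2 / 2 := by gcongr
      _ = (A.maxIrrepDim : ℝ) ^ 2 * A.maxNumParams * (A.maxNumParams / 2) := by ring
      _ ≤ _ := by gcongr
  calc (A.numClasses * (A.beta w * Real.sqrt (A.sumSqNorm w))) ^ 2 / 2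
      = (A.numClasses : ℝ) ^ 2 / 2 * A.beta w ^ 2 * A.sumSqNorm w := by
        rw [mul_pow, mul_pow, Real.sq_sqrt hS]
        ring
    _ ≤ _ := by gcongr

/-- Below the resolution of the margin, and for margins at least `1`, the bound is trivial. -/
theorem IsModel.expectedLoss_le_empiricalLoss (hL : 0 < L) {w : A.Params} (hw : A.IsModel w)
    {X : Type*} [MeasurableSpace X] {ρ : X → Matrix (Fin (A.dim 0)) (Fin (A.dim 0)) ℂ}
    (hρ : ∀ x, IsDensityMatrix (ρ x)) (D : Measure (X × Fin A.numClasses))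
    [IsProbabilityMeasure D] {N : ℕ} (hN : 0 < N) {γ : ℝ}
    (h : 1 ≤ γ ∨ 3 * (A.beta w * Real.sqrt (A.sumSqNorm w)) ≤ γ)
    (s : Fin N → X × Fin A.numClasses) :
    expectedLoss D (A.output w ρ) 0 ≤ empiricalLoss s (A.output w ρ) γ := by
  refine expectedLoss_le_empiricalLoss_of_le D hN (fun x y k => ?_) s
  rcases h with h | h
  · linarith [hw.output_le_one hρ x y, hw.output_nonneg hρ x k]
  · obtain ⟨Θ, hΘ, hout⟩ := hw.exists_output_eq hL
    set B := A.beta w * Real.sqrt (A.sumSqNorm w) with hB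
    have hB0 : 0 ≤ B := mul_nonneg (zero_le_one.trans (one_le_beta hL w)) (Real.sqrt_nonneg _)
    -- Cauchy–Schwarz with `√2 ≤ 3 / 2`; the two scores of a margin then give `3 * B`.
    have hle : ∀ k, |∑ p, Θ k p * realFeatures (ρ x) p| ≤ B * (3 / 2) := fun k => by
      refine abs_le_of_sq_le_sq ?_ (by positivity)
      have h1 := Finset.sum_mul_sq_le_sq_mul_sq Finset.univ (Θ k) (realFeatures (ρ x))
      have h2 := (Finset.single_le_sum (f := fun k => ∑ p, Θ k p ^ 2)
        (fun k _ => Finset.sum_nonneg fun p _ => sq_nonneg _) (Finset.mem_univ k)).trans hΘ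
      have h3 := mul_le_mul h2 (sum_realFeatures_sq_le (hρ x))
        (Finset.sum_nonneg fun _ _ => sq_nonneg _) (sq_nonneg _)
      refine (h1.trans h3).trans ?_
      nlinarith [sq_nonneg B]
    rw [hout ρ hρ, hout ρ hρ]
    linarith [(abs_le.1 (hle y)).2, (abs_le.1 (hle k)).1]

/-- The excess term at grid radius `γ * (i + 1)` is dominated by the complexity term. -/
theorem excess_le_complexity (hL : 0 < L) {w : A.Params}
    (hK : A.numClasses ≤ A.maxIrrepDim * A.maxNumParams) {N : ℕ} (hN : 0 < N) {γ δ R : ℝ}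
    (hγ : 0 < γ) (hγ1 : γ ≤ 1) (hδ : 0 < δ) (hR : R ≤ 4 * (A.beta w * Real.sqrt (A.sumSqNorm w)))
    (h0 : 0 < Real.sqrt (A.sumSqNorm w))
    (h : Real.sqrt (A.sumSqNorm w) ≤ γ * Real.sqrt N) :
    (2 * (4 / γ) * A.numClasses * R * Real.sqrt (2 * N) +
        Real.sqrt (2 * N * Real.log (1 / (δ / N)))) / N ≤
      100 * Real.sqrt (A.complexity w N γ δ / (γ ^ 2 * N)) := by
  have hN' : (0 : ℝ) < N := by exact_mod_cast hN
  have hsN : 0 < Real.sqrt N := Real.sqrt_pos.2 hN'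
  have hsN2 : Real.sqrt N * Real.sqrt N = N := Real.mul_self_sqrt hN'.le
  have hβ := one_le_beta hL w
  set B := A.beta w * Real.sqrt (A.sumSqNorm w) with hB
  have hB0 : 0 ≤ B := by positivity
  have hV := sq_numClasses_mul_le hL w hK
  have hlog := log_le_posLog_netSize (δ := δ) hL hN hδ h0 h
  rw [← hB] at hV
  set V := (A.maxIrrepDim : ℝ) ^ 2 * A.maxNumParams *
    Real.log (∑ j : Fin L, (2 : ℝ) ^ (A.iso j).numParams) * A.beta w ^ 2 * A.sumSqNorm w with hVdef
  set P := Real.posLog (N * L * A.netSize w N γ / δ) with hP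
  have hP0 : 0 ≤ P := Real.posLog_nonneg
  have hV0 : 0 ≤ V := le_trans (by positivity) hV
  have hc : A.complexity w N γ δ = V + P := rfl
  have hs2 : Real.sqrt 2 ≤ 3 / 2 := Real.sqrt_le_iff.2 ⟨by norm_num, by norm_num⟩
  set Q := Real.sqrt (A.complexity w N γ δ / (γ ^ 2 * N)) with hQ
  have hQ2 : Q ^ 2 * (γ ^ 2 * N) = V + P := by
    rw [hQ, Real.sq_sqrt (div_nonneg (by rw [hc]; positivity) (by positivity)), hc]
    field_simp
  have hQ0 : 0 ≤ Q := Real.sqrt_nonneg _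
  have hKB : A.numClasses * B ≤ 2 * (Q * (γ * Real.sqrt N)) := by
    refine abs_le_of_sq_le_sq' ?_ (by positivity) |>.2
    have : (2 * (Q * (γ * Real.sqrt N))) ^ 2 = 4 * (V + P) := by
      linear_combination 4 * hQ2 + 4 * Q ^ 2 * γ ^ 2 * hsN2
    rw [this]
    linarith
  have hlogQ : Real.sqrt (Real.log (1 / (δ / N))) ≤ Q * Real.sqrt N := by
    refine Real.sqrt_le_iff.2 ⟨by positivity, ?_⟩
    rw [one_div_div, mul_pow, Real.sq_sqrt hN'.le]
    refine hlog.trans ?_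
    -- The confidence term carries no `1 / γ`; it fits under the common denominator `γ ^ 2 * N`
    -- because `γ ≤ 1`.
    have h2 : γ ^ 2 ≤ 1 := pow_le_one₀ hγ.le hγ1
    calc P ≤ Q ^ 2 * N * γ ^ 2 := by linarith
      _ ≤ Q ^ 2 * N * 1 := by gcongr
      _ = _ := mul_one _
  rw [div_le_iff₀ hN', Real.sqrt_mul (by norm_num) (N : ℝ), mul_assoc 2 (N : ℝ),
    Real.sqrt_mul (by norm_num) (N * _), Real.sqrt_mul hN'.le]
  -- The constant is `8 * 4 * (3 / 2) * 2 = 96`, the last `2` coming from `hKB`; the confidence term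
  -- adds `2`, so `100` suffices.
  have e1 : 2 * (4 / γ) * A.numClasses * R * (Real.sqrt 2 * Real.sqrt N) ≤ 96 * (Q * N) := by
    calc 2 * (4 / γ) * A.numClasses * R * (Real.sqrt 2 * Real.sqrt N)
        ≤ 2 * (4 / γ) * A.numClasses * (4 * B) * (3 / 2 * Real.sqrt N) := by gcongr
      _ = 48 / γ * Real.sqrt N * (A.numClasses * B) := by ring
      _ ≤ 48 / γ * Real.sqrt N * (2 * (Q * (γ * Real.sqrt N))) := by gcongr
      _ = 96 * (Q * (Real.sqrt N * Real.sqrt N)) := by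
          field_simp
          ring
      _ = _ := by rw [hsN2]
  have e2 : Real.sqrt 2 * (Real.sqrt N * Real.sqrt (Real.log (1 / (δ / N)))) ≤ 2 * (Q * N) := by
    calc _ ≤ 3 / 2 * (Real.sqrt N * (Q * Real.sqrt N)) := by gcongr
      _ = 3 / 2 * (Q * N) := by linear_combination (3 / 2 * Q) * hsN2
      _ ≤ _ := by nlinarith [mul_nonneg hQ0 hN'.le]
  nlinarith [mul_nonneg hQ0 hN'.le]

/-- If the radius of the model exceeds the margin scale, the complexity term is at least `1`. -/
theorem one_le_complexity (hL : 0 < L) {w : A.Params}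
    (hK : A.numClasses ≤ A.maxIrrepDim * A.maxNumParams) (hK0 : 0 < A.numClasses) {N : ℕ}
    (hN : 0 < N) {γ δ : ℝ} (hγ : 0 < γ)
    (h : γ * Real.sqrt N ≤ A.beta w * Real.sqrt (A.sumSqNorm w)) :
    1 ≤ 100 * Real.sqrt (A.complexity w N γ δ / (γ ^ 2 * N)) := by
  have hN' : (0 : ℝ) < N := by exact_mod_cast hN
  have hK1 : (1 : ℝ) ≤ A.numClasses := by exact_mod_cast hK0
  have hV := sq_numClasses_mul_le hL w hK
  have hP0 : 0 ≤ Real.posLog (N * L * A.netSize w N γ / δ) := Real.posLog_nonneg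
  have h1 : (γ * Real.sqrt N) ^ 2 ≤ (A.numClasses * (A.beta w * Real.sqrt (A.sumSqNorm w))) ^ 2 :=
    pow_le_pow_left₀ (by positivity)
      (h.trans (le_mul_of_one_le_left ((by positivity : 0 ≤ γ * Real.sqrt N).trans h) hK1)) 2
  rw [mul_pow, Real.sq_sqrt hN'.le] at h1
  have h2 : 1 / 4 ≤ A.complexity w N γ δ / (γ ^ 2 * N) := by
    rw [le_div_iff₀ (by positivity), complexity]
    have : 0 < γ ^ 2 * N := by positivity
    linarith
  have h3 : (1 / 2 : ℝ) ≤ Real.sqrt (A.complexity w N γ δ / (γ ^ 2 * N)) :=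
    Real.le_sqrt_of_sq_le (by norm_num at h2 ⊢; exact h2)
  linarith

/-- A model that violates the bound violates the bound for linear classes on a grid of radii. -/
theorem IsModel.exists_grid_of_violation (hL : 0 < L) {w : A.Params} (hw : A.IsModel w)
    {X : Type*} [MeasurableSpace X] {ρ : X → Matrix (Fin (A.dim 0)) (Fin (A.dim 0)) ℂ}
    (hρ : ∀ x, IsDensityMatrix (ρ x)) (D : Measure (X × Fin A.numClasses))
    [IsProbabilityMeasure D] {N : ℕ} (hN : 0 < N) {γ δ : ℝ} (hγ : 0 < γ) (hδ : 0 < δ)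
    {s : Fin N → X × Fin A.numClasses}
    (hs : ¬ expectedLoss D (A.output w ρ) 0 ≤ empiricalLoss s (A.output w ρ) γ +
      100 * Real.sqrt (A.complexity w N γ δ / (γ ^ 2 * N))) :
    ∃ i : Fin N, ∃ Θ : Fin A.numClasses → Option (Fin (A.dim 0) × Fin (A.dim 0)) × Bool → ℝ,
      ∑ k, ∑ p, Θ k p ^ 2 ≤ (γ * (i.val + 1 : ℕ)) ^ 2 ∧
        ¬ expectedLoss D (fun x k => ∑ p, Θ k p * realFeatures (ρ x) p) 0 ≤
          empiricalLoss s (fun x k => ∑ p, Θ k p * realFeatures (ρ x) p) γ +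
            (2 * (4 / γ) * A.numClasses * (γ * (i.val + 1 : ℕ)) * Real.sqrt (2 * N) +
              Real.sqrt (2 * N * Real.log (1 / (δ / N)))) / N := by
  have hN' : (1 : ℝ) ≤ N := by exact_mod_cast hN
  -- The first sample point supplies a label, so there is a class, and a density matrix, so the
  -- dimension count applies.
  have hz : (s ⟨0, hN⟩).2.val < A.numClasses := (s ⟨0, hN⟩).2.2
  have hK0 : 0 < A.numClasses := by omega
  have hK := hw.numClasses_le hL (hρ (s ⟨0, hN⟩).1)
  have hβ := one_le_beta hL w
  set B := A.beta w * Real.sqrt (A.sumSqNorm w) with hB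
  have hsqrt : 0 ≤ 100 * Real.sqrt (A.complexity w N γ δ / (γ ^ 2 * N)) := by positivity
  have htriv : ¬ (1 ≤ γ ∨ 3 * B ≤ γ) := fun h => hs
    ((hw.expectedLoss_le_empiricalLoss hL hρ D hN h s).trans (le_add_of_nonneg_right hsqrt))
  rw [not_or, not_le, not_le] at htriv
  obtain ⟨hγ1, hBlow⟩ := htriv
  have hBup : B < γ * Real.sqrt N := by
    by_contra! hcon
    have h1 := one_le_complexity (δ := δ) hL hK hK0 hN hγ hcon
    exact hs ((expectedLoss_le_one D _ 0).trans (by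
      linarith [empiricalLoss_nonneg s (A.output w ρ) γ]))
  have hB0 : 0 < B := by linarith
  have hS0 : 0 < Real.sqrt (A.sumSqNorm w) := by
    refine (Real.sqrt_nonneg _).lt_of_ne fun h => ?_
    rw [hB, ← h, mul_zero] at hB0
    exact lt_irrefl _ hB0
  have hSB : Real.sqrt (A.sumSqNorm w) ≤ B := le_mul_of_one_le_left hS0.le hβ
  have hsN : Real.sqrt N ≤ N := Real.sqrt_le_iff.2 ⟨by linarith, by nlinarith⟩
  -- The least grid multiple of `γ` covering `B`. It is at most `N` since `B < γ * √N`, and rounding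
  -- up costs at most a factor `4` since `γ < 3 * B`.
  set c := ⌈B / γ⌉₊ with hc
  have hc0 : 0 < c := Nat.ceil_pos.2 (by positivity)
  have hcN : c ≤ N := Nat.ceil_le.2 (by
    rw [div_le_iff₀ hγ]
    nlinarith)
  have hcB : B ≤ γ * c := by
    have := Nat.le_ceil (B / γ)
    rwa [div_le_iff₀' hγ] at this
  have hcB4 : γ * c ≤ 4 * B := by
    have h1 : (c : ℝ) < B / γ + 1 := Nat.ceil_lt_add_one (by positivity)
    have h2 : γ * c < γ * (B / γ + 1) := mul_lt_mul_of_pos_left h1 hγ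
    have h3 : γ * (B / γ + 1) = B + γ := by field_simp
    linarith
  obtain ⟨Θ, hΘ, hout⟩ := hw.exists_output_eq hL
  have hout' : A.output w ρ = fun x k =>
      (A.numClasses : ℝ)⁻¹ + ∑ p, Θ k p * realFeatures (ρ x) p :=
    funext fun x => funext fun k => hout ρ hρ x k
  have hex := excess_le_complexity hL hK hN hγ hγ1.le hδ hcB4 hS0 (hSB.trans hBup.le)
  -- Index `i` stands for the radius `γ * (i + 1)`, hence the shift; `c` is positive.
  refine ⟨⟨c - 1, by omega⟩, Θ, ?_⟩
  rw [show (⟨c - 1, by omega⟩ : Fin N).val + 1 = c by simp only; omega]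
  refine ⟨hΘ.trans (pow_le_pow_left₀ hB0.le hcB 2), fun hle => hs ?_⟩
  rw [hout', expectedLoss_const_add, empiricalLoss_const_add]
  exact hle.trans (add_le_add le_rfl hex)

end Architecture

end EquivariantQML

end

/-! ### The union bound over the grid of radii -/

theorem mainTheorem3 :
    ∃ C : ℝ, 0 < C ∧
      ∀ (G : Type*) [Group G] [TopologicalSpace G] [IsTopologicalGroup G] [CompactSpace G]
        (L : ℕ) (_hL : 0 < L) (A : EquivariantQML.Architecture G L)
        (X : Type*) [MeasurableSpace X]
        (ρ : X → Matrix (Fin (A.dim 0)) (Fin (A.dim 0)) ℂ)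
        (_hρ : ∀ x, EquivariantQML.IsDensityMatrix (ρ x))
        (_hρm : ∀ i k, Measurable fun x => ρ x i k)
        (D : Measure (X × Fin A.numClasses)) [IsProbabilityMeasure D]
        (N : ℕ) (_hN : 0 < N) (γ δ : ℝ) (_hγ : 0 < γ) (_hδ : 0 < δ) (_hδ1 : δ < 1),
        -- the samples for which the bound fails for some model form a set of outer measure `≤ δ`
        (Measure.pi fun _ : Fin N => D)
            {s | ∃ w : A.Params, A.IsModel w ∧
              ¬ EquivariantQML.expectedLoss D (A.output w ρ) 0 ≤
                EquivariantQML.empiricalLoss s (A.output w ρ) γ +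
                  C * Real.sqrt (A.complexity w N γ δ / (γ ^ 2 * N))}
          ≤ ENNReal.ofReal δ := by
  refine ⟨100, by norm_num, ?_⟩
  intro G _ _ _ _ L hL A X _ ρ hρ hρm D _ N hN γ δ hγ hδ hδ1
  have hN' : (1 : ℝ) ≤ N := by exact_mod_cast hN
  have hgrid := fun i : Fin N =>
    EquivariantQML.measure_exists_linear_margin_le D
      (φ := fun x => EquivariantQML.Architecture.realFeatures (ρ x))
      (EquivariantQML.Architecture.measurable_realFeatures hρm)
      (fun x => EquivariantQML.Architecture.sum_realFeatures_sq_le (hρ x)) hN hγ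
      (B := γ * (i.val + 1 : ℕ)) (by positivity) (δ := δ / N) (by positivity)
      ((div_le_self hδ.le hN').trans hδ1.le)
  -- Monotonicity and subadditivity hold for outer measure, so the failure set need not be
  -- measurable. The `N` failure bounds `δ / N` add up to `δ`.
  refine (measure_mono fun s hs => ?_).trans ((measure_iUnion_fintype_le _ _).trans
    ((Finset.sum_le_sum fun i _ => hgrid i).trans ?_))
  · obtain ⟨w, hw, hlt⟩ := hs
    obtain ⟨i, Θ, hΘ, hviol⟩ := hw.exists_grid_of_violation hL hρ D hN hγ hδ hlt
    exact Set.mem_iUnion.2 ⟨i, Θ, hΘ, hviol⟩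
  · rw [Finset.sum_const, Finset.card_univ, Fintype.card_fin, nsmul_eq_mul,
      ← ENNReal.ofReal_natCast, ← ENNReal.ofReal_mul (Nat.cast_nonneg _),
      mul_div_cancel₀ _ (by positivity)]
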